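/- **Setting.** Let $(\mathcal{A},\mathcal{H},D)_\sigma$ be a twisted spectral triple: $\mathcal{H}=\mathcal{H}^+\oplus\mathcal{H}^-$ is a $\mathbb{Z}_2$-graded Hilbert space; $\mathcal{A}$ is a unital involutive complex algebra with a unital $*$-representation by even bounded operators on $\mathcal{H}$; $\sigma$ is an automorphism of the algebra $\mathcal{A}$ with $\sigma(a)^*=\sigma^{-1}(a^*)$; $D$ is a selfadjoint unbounded operator on $\mathcal{H}$ which is odd (that is, $\operatorname{dom}D=\operatorname{dom}D^+\oplus\operatorname{dom}D^-$ with $\operatorname{dom}D^\pm=\operatorname{dom}D\cap\mathcal{H}^\pm$, and $D$ maps $\operatorname{dom}D^\pm$ to $\mathcal{H}^\mp$) and such that $(D+i)^{-1}$ is compact, $a(\operatorname{dom}D)\subset\operatorname{dom}D$ and $Da-\sigma(a)D$ is bounded for all $a\in\mathcal{A}$. Write $d_\sigma a=[D,a]_\sigma\in\mathcal{L}(\mathcal{H})$ for the bounded extension of $Da-\sigma(a)D$, and let $\Omega^1_{D,\sigma}(\mathcal{A})\subset\mathcal{L}(\mathcal{H})$ be the $\mathcal{A}$-bimodule spanned by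 the operators $a\,d_\sigma b$, $a,b\in\mathcal{A}$. Let $\mathcal{E}$ be a finitely generated projective right $\mathcal{A}$-module, and let $(\mathcal{E}^\sigma,\sigma^{\mathcal{E}})$ be a $\sigma$-translation of $\mathcal{E}$: a finitely generated projective right $\mathcal{A}$-module $\mathcal{E}^\sigma$ with a $\mathbb{C}$-linear isomorphism $\sigma^{\mathcal{E}}:\mathcal{E}\to\mathcal{E}^\sigma$ such that $\sigma^{\mathcal{E}}(\xi a)=\sigma^{\mathcal{E}}(\xi)\sigma(a)$. Suppose that $\mathcal{E}$ carries a $\sigma$-Hermitian structure, that is: * a Hermitian metric $(\cdot,\cdot):\mathcal{E}\times\mathcal{E}\to\mathcal{A}$: it is $\mathcal{A}$-antilinear in the first and $\mathcal{A}$-linear in the second variable, $(\xi,\xi)$ acts as a positive operator on $\mathcal{H}$ for every $\xi$, and $\xi\mapsto(\xi,\cdot)$ is a bijection of $\mathcal{E}$ onto $\operatorname{Hom}_{\mathcal{A}}(\mathcal{E},\mathcal{A})$; * an isomorphism of right modules $\mathfrak{s}:\mathcal{E}^\sigma\to\mathcal{E}$ with $(\xi_1,\mathfrak{s}\sigma^{\mathcal{E}}(\xi_2))=\sigma[(\mathfrak{s}\sigma^{\mathcal{E}}(\xi_1),\xi_2)]$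 for all $\xi_1,\xi_2\in\mathcal{E}$. Let $\mathcal{H}(\mathcal{E})=\mathcal{E}\otimes_{\mathcal{A}}\mathcal{H}$, with inner product $\langle\xi_1\otimes\zeta_1,\xi_2\otimes\zeta_2\rangle=\langle\zeta_1,(\xi_1,\xi_2)\zeta_2\rangle$ and grading $\mathcal{H}^\pm(\mathcal{E})=\mathcal{E}\otimes_{\mathcal{A}}\mathcal{H}^\pm$, and likewise $\mathcal{H}(\mathcal{E}^\sigma)=\mathcal{E}^\sigma\otimes_{\mathcal{A}}\mathcal{H}$, $\mathcal{H}^\pm(\mathcal{E}^\sigma)=\mathcal{E}^\sigma\otimes_{\mathcal{A}}\mathcal{H}^\pm$. A densely defined operator $T$ from $\mathcal{H}(\mathcal{E})$ to $\mathcal{H}(\mathcal{E}^\sigma)$ is called $\mathfrak{s}$-selfadjoint if $T=T^\dagger$, where the $\mathfrak{s}$-adjoint $T^\dagger$ is the operator with graph $$\{(x,y)\in\mathcal{H}(\mathcal{E})\times\mathcal{H}(\mathcal{E}^\sigma)\,:\ \langle x,(\mathfrak{s}\otimes1)Tz\rangle=\langle(\mathfrak{s}\otimes1)y,z\rangle\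 \text{ for all } z\in\operatorname{dom}T\}.$$ A $\sigma$-connection on $\mathcal{E}$ is a $\mathbb{C}$-linear map $\nabla:\mathcal{E}\to\mathcal{E}^\sigma\otimes_{\mathcal{A}}\Omega^1_{D,\sigma}(\mathcal{A})$ with $\nabla(\xi a)=(\nabla\xi)a+\sigma^{\mathcal{E}}(\xi)\otimes d_\sigma a$. It is $\sigma$-Hermitian if, for all $\xi,\eta\in\mathcal{E}$, $$(\xi,\mathfrak{s}\nabla\eta)-(\mathfrak{s}\nabla\xi,\eta)=d_\sigma\big((\mathfrak{s}\sigma^{\mathcal{E}}(\xi),\eta)\big)\quad\text{in }\mathcal{L}(\mathcal{H}),$$ where $(\xi,\mathfrak{s}(\theta\otimes\omega)):=(\xi,\mathfrak{s}\theta)\,\omega$ and $(\mathfrak{s}(\theta\otimes\omega),\eta):=\omega^*(\mathfrak{s}\theta,\eta)$ for $\theta\in\mathcal{E}^\sigma$, $\omega\in\Omega^1_{D,\sigma}(\mathcal{A})$. The coupled operator $D_\nabla$ from $\mathcal{H}(\mathcal{E})$ to $\mathcal{H}(\mathcal{E}^\sigma)$ has domain $\mathcal{E}\otimes_{\mathcal{A}}\operatorname{dom}D$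 and is given by $$D_\nabla(\xi\otimes\zeta)=\sigma^{\mathcal{E}}(\xi)\otimes D\zeta+\sum_\alpha\xi_\alpha\otimes\omega_\alpha(\zeta)\qquad\text{if }\nabla\xi=\sum_\alpha\xi_\alpha\otimes\omega_\alpha .$$ It is odd; let $D_\nabla^\pm:\mathcal{E}\otimes_{\mathcal{A}}\operatorname{dom}D^\pm\to\mathcal{H}^\mp(\mathcal{E}^\sigma)$ be its components, and let $\operatorname{coker}D_\nabla^\pm=\mathcal{H}^\mp(\mathcal{E}^\sigma)/\operatorname{ran}D_\nabla^\pm$. **Proposition.** Let $\nabla$ be a $\sigma$-Hermitian $\sigma$-connection on $\mathcal{E}$. Then the coupled operator $D_\nabla$ is $\mathfrak{s}$-selfadjoint (in particular densely defined), and there are linear isomorphisms $$\operatorname{coker}D_\nabla^+\simeq\ker D_\nabla^-\qquad\text{and}\qquad\operatorname{coker}D_\nabla^-\simeq\ker D_\nabla^+ .$$ -/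

import Mathlib

open scoped TensorProduct ComplexConjugate InnerProductSpace

noncomputable section

set_option linter.unusedSectionVars false

/-! ### Balanced tensor products over a noncommutative complex algebra -/

section BalancedTensor

variable {A : Type*} [Ring A] [Algebra ℂ A]
  {M : Type*} [AddCommGroup M] [Module ℂ M]
  {N : Type*} [AddCommGroup N] [Module ℂ N]
  {P : Type*} [AddCommGroup P] [Module ℂ P]

/-- The relations `ξa ⊗ m = ξ ⊗ am`. Right modules are modules over `Aᵐᵒᵖ`, and a left action
of `A` on `M` is given as an algebra homomorphism `ρ : A → End_ℂ(M)`. -/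
def balancedRel (E : Type*) [AddCommGroup E] [Module ℂ E] [Module Aᵐᵒᵖ E]
    (ρ : A →ₐ[ℂ] Module.End ℂ M) : Submodule ℂ (E ⊗[ℂ] M) :=
  Submodule.span ℂ {t | ∃ (ξ : E) (a : A) (m : M),
    t = (MulOpposite.op a • ξ) ⊗ₜ[ℂ] m - ξ ⊗ₜ[ℂ] (ρ a m)}

/-- The tensor product `E ⊗_A M` of a right `A`-module `E` and a left `A`-module `M`
(with left action `ρ`), as a complex vector space. -/
abbrev BalancedTensor (E : Type*) [AddCommGroup E] [Module ℂ E] [Module Aᵐᵒᵖ E]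
    (ρ : A →ₐ[ℂ] Module.End ℂ M) : Type _ :=
  (E ⊗[ℂ] M) ⧸ balancedRel E ρ

namespace BalancedTensor

variable {E : Type*} [AddCommGroup E] [Module ℂ E] [Module Aᵐᵒᵖ E]
  {F : Type*} [AddCommGroup F] [Module ℂ F] [Module Aᵐᵒᵖ F]

/-- The bilinear map `(ξ, m) ↦ ξ ⊗ m`. -/
def tmulHom (E : Type*) [AddCommGroup E] [Module ℂ E] [Module Aᵐᵒᵖ E]
    (ρ : A →ₐ[ℂ] Module.End ℂ M) : E →ₗ[ℂ] M →ₗ[ℂ] BalancedTensor E ρ :=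
  (TensorProduct.mk ℂ E M).compr₂ (balancedRel E ρ).mkQ

/-- The pure tensor `ξ ⊗ m` in `E ⊗_A M`. -/
def tmul (ρ : A →ₐ[ℂ] Module.End ℂ M) (ξ : E) (m : M) : BalancedTensor E ρ :=
  tmulHom E ρ ξ m

theorem smul_tmul (ρ : A →ₐ[ℂ] Module.End ℂ M) (a : A) (ξ : E) (m : M) :
    tmul ρ (MulOpposite.op a • ξ) m = tmul ρ ξ (ρ a m) :=
  (Submodule.Quotient.eq _).2 (Submodule.subset_span ⟨ξ, a, m, rfl⟩)

/-- Universal property: a balanced bilinear (or bi-antilinear, according to the ring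
homomorphism `τ`) map on `E × M` induces a map on `E ⊗_A M`. -/
def lift {τ : ℂ →+* ℂ} (ρ : A →ₐ[ℂ] Module.End ℂ M) (f : E →ₛₗ[τ] M →ₛₗ[τ] P)
    (hf : ∀ ξ a m, f (MulOpposite.op a • ξ) m = f ξ (ρ a m)) :
    BalancedTensor E ρ →ₛₗ[τ] P :=
  (balancedRel E ρ).liftQ (TensorProduct.lift f) (by
    refine Submodule.span_le.2 ?_
    rintro _ ⟨ξ, a, m, rfl⟩
    simp [hf])

@[simp]
theorem lift_tmul {τ : ℂ →+* ℂ} (ρ : A →ₐ[ℂ] Module.End ℂ M) (f : E →ₛₗ[τ] M →ₛₗ[τ] P)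
    (hf : ∀ ξ a m, f (MulOpposite.op a • ξ) m = f ξ (ρ a m)) (ξ : E) (m : M) :
    lift ρ f hf (tmul ρ ξ m) = f ξ m :=
  rfl

theorem induction {ρ : A →ₐ[ℂ] Module.End ℂ M} {p : BalancedTensor E ρ → Prop}
    (ht : ∀ ξ m, p (tmul ρ ξ m)) (hadd : ∀ u v, p u → p v → p (u + v))
    (u : BalancedTensor E ρ) : p u := by
  obtain ⟨t, rfl⟩ := (balancedRel E ρ).mkQ_surjective u
  induction t using TensorProduct.induction_on with
  | zero => simpa [tmul] using ht 0 0
  | tmul ξ m => exact ht ξ m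
  | add x y hx hy => rw [map_add]; exact hadd _ _ hx hy

/-- `1 ⊗ g : E ⊗_A M → E ⊗_A N` for a map `g` of left modules. -/
def mapRight (ρ : A →ₐ[ℂ] Module.End ℂ M) (ρ' : A →ₐ[ℂ] Module.End ℂ N) (g : M →ₗ[ℂ] N)
    (hg : ∀ a m, g (ρ a m) = ρ' a (g m)) :
    BalancedTensor E ρ →ₗ[ℂ] BalancedTensor E ρ' :=
  lift ρ ((tmulHom E ρ').compl₂ g) (fun ξ a m => by
    rw [LinearMap.compl₂_apply, LinearMap.compl₂_apply, hg]
    exact smul_tmul ρ' a ξ (g m))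

@[simp]
theorem mapRight_tmul (ρ : A →ₐ[ℂ] Module.End ℂ M) (ρ' : A →ₐ[ℂ] Module.End ℂ N)
    (g : M →ₗ[ℂ] N) (hg : ∀ a m, g (ρ a m) = ρ' a (g m)) (ξ : E) (m : M) :
    mapRight ρ ρ' g hg (tmul ρ ξ m) = tmul ρ' ξ (g m) :=
  rfl

/-- `f ⊗ 1 : E ⊗_A M → F ⊗_A M` for a map `f` of right modules. -/
def mapLeft [IsScalarTower ℂ Aᵐᵒᵖ E] [IsScalarTower ℂ Aᵐᵒᵖ F]
    (ρ : A →ₐ[ℂ] Module.End ℂ M) (f : E →ₗ[Aᵐᵒᵖ] F) :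
    BalancedTensor E ρ →ₗ[ℂ] BalancedTensor F ρ :=
  lift ρ ((tmulHom F ρ).comp (f.restrictScalars ℂ)) (fun ξ a m => by
    rw [LinearMap.comp_apply, LinearMap.comp_apply, LinearMap.restrictScalars_apply, map_smul]
    exact smul_tmul ρ a (f ξ) m)

@[simp]
theorem mapLeft_tmul [IsScalarTower ℂ Aᵐᵒᵖ E] [IsScalarTower ℂ Aᵐᵒᵖ F]
    (ρ : A →ₐ[ℂ] Module.End ℂ M) (f : E →ₗ[Aᵐᵒᵖ] F) (ξ : E) (m : M) :
    mapLeft ρ f (tmul ρ ξ m) = tmul ρ (f ξ) m :=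
  rfl

/-- The contraction `φ ⊗ 1 : E ⊗_A M → A ⊗_A M = M`, `ξ ⊗ m ↦ φ(ξ) m`, for `φ` in the dual module
`Hom_A(E, A)`. -/
def contract [IsScalarTower ℂ Aᵐᵒᵖ E] (ρ : A →ₐ[ℂ] Module.End ℂ M) (φ : E →ₗ[Aᵐᵒᵖ] A) :
    BalancedTensor E ρ →ₗ[ℂ] M :=
  lift ρ (ρ.toLinearMap.comp (φ.restrictScalars ℂ)) (fun ξ a m => by simp)

@[simp]
theorem contract_tmul [IsScalarTower ℂ Aᵐᵒᵖ E] (ρ : A →ₐ[ℂ] Module.End ℂ M)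
    (φ : E →ₗ[Aᵐᵒᵖ] A) (ξ : E) (m : M) : contract ρ φ (tmul ρ ξ m) = ρ (φ ξ) m :=
  rfl

/-- A finitely generated projective right module is flat: `1 ⊗ g` is injective if `g` is. -/
theorem mapRight_injective [IsScalarTower ℂ Aᵐᵒᵖ E] [Module.Finite Aᵐᵒᵖ E]
    [Module.Projective Aᵐᵒᵖ E] (ρ : A →ₐ[ℂ] Module.End ℂ M) (ρ' : A →ₐ[ℂ] Module.End ℂ N)
    (g : M →ₗ[ℂ] N) (hg : ∀ a m, g (ρ a m) = ρ' a (g m)) (hinj : Function.Injective g) :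
    Function.Injective (mapRight (E := E) ρ ρ' g hg) := by
  obtain ⟨n, f, k, -, -, hfk⟩ := Module.Finite.exists_comp_eq_id_of_projective Aᵐᵒᵖ E
  let unopLin : Aᵐᵒᵖ →ₗ[Aᵐᵒᵖ] A :=
    { toFun := MulOpposite.unop, map_add' := fun _ _ => rfl, map_smul' := fun _ _ => rfl }
  let φ : Fin n → (E →ₗ[Aᵐᵒᵖ] A) := fun j => unopLin ∘ₗ (LinearMap.proj j) ∘ₗ k
  let e : Fin n → E := fun j => f (Pi.single j 1)
  have hE : ∀ ξ : E, ξ = ∑ j, MulOpposite.op (φ j ξ) • e j := by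
    intro ξ
    have hk : ∀ x : Fin n → Aᵐᵒᵖ, x = ∑ j, x j • Pi.single j (1 : Aᵐᵒᵖ) := by
      intro x
      funext i
      simp [Finset.sum_apply, Pi.single_apply]
    have h1 : f (k ξ) = ξ := LinearMap.congr_fun hfk ξ
    conv_lhs => rw [← h1, hk (k ξ)]
    rw [map_sum]
    refine Finset.sum_congr rfl fun j _ => ?_
    exact map_smul f (k ξ j) _
  have key : ∀ u : BalancedTensor E ρ, u = ∑ j, tmul ρ (e j) (contract ρ (φ j) u) := by
    intro u
    induction u using BalancedTensor.induction with
    | ht ξ m =>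
      have h2 : tmul ρ ξ m = tmul ρ (∑ j, MulOpposite.op (φ j ξ) • e j) m := by rw [← hE ξ]
      simp only [contract_tmul, ← smul_tmul]
      refine h2.trans ?_
      simp only [tmul, map_sum, LinearMap.sum_apply]
    | hadd u v hu hv =>
      conv_lhs => rw [hu, hv]
      rw [← Finset.sum_add_distrib]
      exact Finset.sum_congr rfl fun j _ => by simp [tmul]
  have comm : ∀ (ψ : E →ₗ[Aᵐᵒᵖ] A) (u : BalancedTensor E ρ),
      contract ρ' ψ (mapRight ρ ρ' g hg u) = g (contract ρ ψ u) := by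
    intro ψ u
    induction u using BalancedTensor.induction with
    | ht ξ m => simp [hg]
    | hadd u v hu hv => simp [hu, hv]
  refine (injective_iff_map_eq_zero _).2 fun u hu => ?_
  have h0 : ∀ j, contract ρ (φ j) u = 0 := fun j => hinj (by rw [← comm, hu]; simp)
  rw [key u]
  simp [h0, tmul]

end BalancedTensor

end BalancedTensor

/-! ### Twisted spectral triples -/

/-- A twisted spectral triple `(A, H, D)_σ`. The grading `H = H⁺ ⊕ H⁻` is indexed by `ZMod 2`
(`0` for `+`, `1` for `-`). -/
structure TwistedSpectralTriple (A : Type*) [Ring A] [StarRing A] [Algebra ℂ A] [StarModule ℂ A]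
    (H : Type*) [NormedAddCommGroup H] [InnerProductSpace ℂ H] [CompleteSpace H] where
  /-- The subspaces `H⁺` and `H⁻`. -/
  gr : ZMod 2 → Submodule ℂ H
  /-- `H⁺` and `H⁻` are the orthogonal complements of each other. -/
  gr_orthogonal : ∀ i, gr (i + 1) = (gr i)ᗮ
  /-- The unital involutive representation of `A` by bounded operators. -/
  rep : A →⋆ₐ[ℂ] (H →L[ℂ] H)
  /-- `A` acts by even operators. -/
  rep_even : ∀ (a : A) (i : ZMod 2), ∀ x ∈ gr i, rep a x ∈ gr i
  /-- The twisting automorphism `σ`. -/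
  σ : A ≃ₐ[ℂ] A
  star_σ : ∀ a : A, star (σ a) = σ.symm (star a)
  /-- The unbounded operator `D`. -/
  D : H →ₗ.[ℂ] H
  isSelfAdjoint_D : IsSelfAdjoint D
  /-- The domain of `D` is a graded subspace. -/
  domain_graded : ∀ x ∈ D.domain, ∃ y ∈ D.domain ⊓ gr 0, ∃ z ∈ D.domain ⊓ gr 1, x = y + z
  /-- `D` is odd. -/
  D_odd : ∀ (i : ZMod 2) (x : D.domain), (x : H) ∈ gr i → D x ∈ gr (i + 1)
  /-- The resolvent `(D + i)⁻¹` exists and is a compact operator. -/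
  compact_resolvent : ∃ R : H →L[ℂ] H, IsCompactOperator R ∧
    (∀ x : D.domain, R (D x + Complex.I • (x : H)) = x) ∧
    (∀ y : H, ∃ h : R y ∈ D.domain, D ⟨R y, h⟩ + Complex.I • R y = y)
  /-- `A` preserves the domain of `D`. -/
  rep_domain : ∀ (a : A), ∀ x ∈ D.domain, rep a x ∈ D.domain
  /-- The twisted commutators `Da - σ(a)D` are bounded. -/
  bounded_commutator : ∀ a : A, ∃ C : ℝ, ∀ x : D.domain,
    ‖D ⟨rep a x, rep_domain a x x.2⟩ - rep (σ a) (D x)‖ ≤ C * ‖(x : H)‖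

namespace TwistedSpectralTriple

variable {A : Type*} [Ring A] [StarRing A] [Algebra ℂ A] [StarModule ℂ A]
  {H : Type*} [NormedAddCommGroup H] [InnerProductSpace ℂ H] [CompleteSpace H]
  (S : TwistedSpectralTriple A H)

/-- The left action of `A` on `H`. -/
def ρH : A →ₐ[ℂ] Module.End ℂ H where
  toFun a := (S.rep a : H →ₗ[ℂ] H)
  map_one' := by ext; simp
  map_mul' a b := by ext; simp
  map_zero' := by ext; simp
  map_add' a b := by ext; simp
  commutes' c := by ext; simp [Algebra.algebraMap_eq_smul_one]

@[simp]
theorem ρH_apply (a : A) (x : H) : S.ρH a x = S.rep a x := rfl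

/-- The left action of `A` on the domain of `D`. -/
def ρDom : A →ₐ[ℂ] Module.End ℂ S.D.domain where
  toFun a := (S.rep a : H →ₗ[ℂ] H).restrict (S.rep_domain a)
  map_one' := by ext; simp
  map_mul' a b := by ext; simp
  map_zero' := by ext; simp
  map_add' a b := by ext; simp
  commutes' c := by ext; simp [Algebra.algebraMap_eq_smul_one]

@[simp]
theorem coe_ρDom_apply (a : A) (x : S.D.domain) : (S.ρDom a x : H) = S.rep a x := rfl

theorem exists_twistedCommutator (a : A) :
    ∃ T : H →L[ℂ] H, ∀ x : S.D.domain, T x = S.D (S.ρDom a x) - S.rep (S.σ a) (S.D x) := by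
  obtain ⟨C, hC⟩ := S.bounded_commutator a
  let f : S.D.domain →ₗ[ℂ] H := S.D.toFun ∘ₗ S.ρDom a - (S.ρH (S.σ a)) ∘ₗ S.D.toFun
  let F : S.D.domain →L[ℂ] H := f.mkContinuous C hC
  have hd : DenseRange S.D.domain.subtypeL := by
    have := S.isSelfAdjoint_D.dense_domain
    simpa [DenseRange] using this
  refine ⟨F.extend S.D.domain.subtypeL, fun x => ?_⟩
  exact ContinuousLinearMap.extend_eq F hd S.D.domain.subtypeₗᵢ.isometry.isUniformInducing x

/-- The twisted differential `d_σ a = [D, a]_σ`: the bounded operator on `H` that extends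
`Da - σ(a)D`. -/
def d (a : A) : H →L[ℂ] H := (S.exists_twistedCommutator a).choose

theorem d_apply (a : A) (x : S.D.domain) :
    S.d a x = S.D (S.ρDom a x) - S.rep (S.σ a) (S.D x) :=
  (S.exists_twistedCommutator a).choose_spec x

theorem ext_domain {T T' : H →L[ℂ] H} (h : ∀ x : S.D.domain, T x = T' x) : T = T' := by
  have := S.isSelfAdjoint_D.dense_domain
  refine ContinuousLinearMap.coeFn_injective
    (Continuous.ext_on this T.continuous T'.continuous fun x hx => h ⟨x, hx⟩)

theorem d_mul (a b : A) : S.d (a * b) = S.d a * S.rep b + S.rep (S.σ a) * S.d b := by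
  refine S.ext_domain fun x => ?_
  have h := S.d_apply a (S.ρDom b x)
  rw [coe_ρDom_apply] at h
  simp [d_apply, h]

/-- The space `Ω¹_{D,σ}(A)` of twisted one-forms `Σ aⁱ [D, bⁱ]_σ`, inside the bounded operators. -/
def Ω : Submodule ℂ (H →L[ℂ] H) :=
  Submodule.span ℂ {ω | ∃ a b : A, ω = S.rep a * S.d b}

theorem rep_mul_mem_Ω (a : A) (ω : H →L[ℂ] H) (hω : ω ∈ S.Ω) : S.rep a * ω ∈ S.Ω := by
  induction hω using Submodule.span_induction with
  | mem x hx =>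
    obtain ⟨b, c, rfl⟩ := hx
    exact Submodule.subset_span ⟨a * b, c, by simp [mul_assoc]⟩
  | zero => simp
  | add x y _ _ hx hy => rw [mul_add]; exact S.Ω.add_mem hx hy
  | smul c x _ hx => rw [mul_smul_comm]; exact S.Ω.smul_mem c hx

theorem mul_rep_mem_Ω (a : A) (ω : H →L[ℂ] H) (hω : ω ∈ S.Ω) : ω * S.rep a ∈ S.Ω := by
  induction hω using Submodule.span_induction with
  | mem x hx =>
    obtain ⟨b, c, rfl⟩ := hx
    have : S.rep b * S.d c * S.rep a = S.rep b * S.d (c * a) - S.rep (b * S.σ c) * S.d a := by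
      rw [d_mul, map_mul]; noncomm_ring
    rw [this]
    exact S.Ω.sub_mem (Submodule.subset_span ⟨_, _, rfl⟩) (Submodule.subset_span ⟨_, _, rfl⟩)
  | zero => simp
  | add x y _ _ hx hy => rw [add_mul]; exact S.Ω.add_mem hx hy
  | smul c x _ hx => rw [smul_mul_assoc]; exact S.Ω.smul_mem c hx

theorem d_mem_Ω (a : A) : S.d a ∈ S.Ω := Submodule.subset_span ⟨1, a, by simp⟩

/-- `d_σ a` as an element of `Ω¹_{D,σ}(A)`. -/
def dΩ (a : A) : S.Ω := ⟨S.d a, S.d_mem_Ω a⟩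

/-- The left action of `A` on `Ω¹_{D,σ}(A)`. -/
def ρΩ : A →ₐ[ℂ] Module.End ℂ S.Ω where
  toFun a := (LinearMap.mulLeft ℂ (S.rep a)).restrict (S.rep_mul_mem_Ω a)
  map_one' := LinearMap.ext fun ω => Subtype.ext (by simp)
  map_mul' a b := LinearMap.ext fun ω => Subtype.ext (by
    change S.rep (a * b) * (ω : H →L[ℂ] H) = S.rep a * (S.rep b * ω)
    rw [map_mul, mul_assoc])
  map_zero' := LinearMap.ext fun ω => Subtype.ext (by simp)
  map_add' a b := LinearMap.ext fun ω => Subtype.ext (by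
    change S.rep (a + b) * (ω : H →L[ℂ] H) = S.rep a * ω + S.rep b * ω
    rw [map_add, add_mul])
  commutes' c := LinearMap.ext fun ω => Subtype.ext (by simp [Algebra.algebraMap_eq_smul_one])

@[simp]
theorem coe_ρΩ_apply (a : A) (ω : S.Ω) : (S.ρΩ a ω : H →L[ℂ] H) = S.rep a * ω := rfl

/-- The right action of `a ∈ A` on `Ω¹_{D,σ}(A)`. -/
def rightΩ (a : A) : S.Ω →ₗ[ℂ] S.Ω :=
  (LinearMap.mulRight ℂ (S.rep a)).restrict (S.mul_rep_mem_Ω a)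

@[simp]
theorem coe_rightΩ_apply (a : A) (ω : S.Ω) : (S.rightΩ a ω : H →L[ℂ] H) = ω * S.rep a := rfl

theorem gr_isClosed (i : ZMod 2) : IsClosed (S.gr i : Set H) := by
  have h : S.gr i = (S.gr (i + 1))ᗮ := by
    rw [← S.gr_orthogonal, add_assoc, show (1 + 1 : ZMod 2) = 0 from rfl, add_zero]
  rw [h]
  exact Submodule.isClosed_orthogonal _

theorem gr_domain_dense (i : ZMod 2) (x : H) (hx : x ∈ S.gr i) :
    x ∈ closure ((S.D.domain ⊓ S.gr i : Submodule ℂ H) : Set H) := by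
  have : CompleteSpace (S.gr i) := (S.gr_isClosed i).completeSpace_coe
  have hP : ∀ y ∈ S.D.domain, (S.gr i).starProjection y ∈ S.D.domain ⊓ S.gr i := by
    intro y hy
    obtain ⟨y₀, h₀, y₁, h₁, rfl⟩ := S.domain_graded y hy
    have hcase : ∀ (u v : H), u ∈ S.D.domain ⊓ S.gr i → v ∈ S.gr (i + 1) →
        (S.gr i).starProjection (u + v) = u := by
      intro u v hu hv
      rw [S.gr_orthogonal] at hv
      rw [map_add, Submodule.starProjection_eq_self_iff.2 hu.2,
        (Submodule.starProjection_apply_eq_zero_iff _).2 hv, add_zero]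
    have hi : i = 0 ∨ i = 1 := (by decide : ∀ j : ZMod 2, j = 0 ∨ j = 1) i
    rcases hi with rfl | rfl
    · rw [hcase y₀ y₁ h₀ h₁.2]; exact h₀
    · rw [add_comm, hcase y₁ y₀ h₁ h₀.2]; exact h₁
  have hx' : (S.gr i).starProjection x = x := Submodule.starProjection_eq_self_iff.2 hx
  rw [← hx']
  exact map_mem_closure (S.gr i).starProjection.continuous
    (S.isSelfAdjoint_D.dense_domain x) hP

theorem d_odd (a : A) (i : ZMod 2) (x : H) (hx : x ∈ S.gr i) : S.d a x ∈ S.gr (i + 1) := by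
  have h : closure (S.gr (i + 1) : Set H) = S.gr (i + 1) := (S.gr_isClosed (i + 1)).closure_eq
  change S.d a x ∈ (S.gr (i + 1) : Set H)
  rw [← h]
  refine map_mem_closure (S.d a).continuous (S.gr_domain_dense i x hx) ?_
  rintro y ⟨hy, hyi⟩
  have := S.d_apply a ⟨y, hy⟩
  simp only at this
  change S.d a y ∈ S.gr (i + 1)
  rw [this]
  refine Submodule.sub_mem _ (S.D_odd i _ ?_) (S.rep_even _ _ _ (S.D_odd i ⟨y, hy⟩ hyi))
  exact S.rep_even _ _ _ hyi

theorem Ω_odd (ω : H →L[ℂ] H) (hω : ω ∈ S.Ω) (i : ZMod 2) (x : H) (hx : x ∈ S.gr i) :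
    ω x ∈ S.gr (i + 1) := by
  induction hω using Submodule.span_induction with
  | mem ω h =>
    obtain ⟨a, b, rfl⟩ := h
    exact S.rep_even _ _ _ (S.d_odd b i x hx)
  | zero => simp
  | add _ _ _ _ h h' => exact Submodule.add_mem _ h h'
  | smul c _ _ h => exact Submodule.smul_mem _ c h

end TwistedSpectralTriple

/-! ### Hermitian metrics, `σ`-translations, `σ`-connections -/

section Modules

variable {A : Type*} [Ring A] [StarRing A] [Algebra ℂ A] [StarModule ℂ A]
  {H : Type*} [NormedAddCommGroup H] [InnerProductSpace ℂ H] [CompleteSpace H]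
  (S : TwistedSpectralTriple A H)
  (E : Type*) [AddCommGroup E] [Module ℂ E] [Module Aᵐᵒᵖ E] [IsScalarTower ℂ Aᵐᵒᵖ E]
  (Eσ : Type*) [AddCommGroup Eσ] [Module ℂ Eσ] [Module Aᵐᵒᵖ Eσ] [IsScalarTower ℂ Aᵐᵒᵖ Eσ]

/-- A Hermitian metric on the right `A`-module `E`. Positivity of an element of `A` means
positivity of the operator on `H` by which it acts. -/
structure HermitianMetric where
  /-- The pairing, `A`-linear in the second variable. -/
  pair : E → (E →ₗ[Aᵐᵒᵖ] A)
  add_left : ∀ ξ ξ' η, pair (ξ + ξ') η = pair ξ η + pair ξ' η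
  smul_left : ∀ (a : A) ξ η, pair (MulOpposite.op a • ξ) η = star a * pair ξ η
  pos : ∀ ξ, (S.rep (pair ξ ξ)).IsPositive
  nondegenerate : Function.Bijective pair

/-- A `σ`-translation of `E`: a `ℂ`-linear isomorphism `σ^E : E → E^σ` such that
`σ^E(ξa) = σ^E(ξ)σ(a)`. -/
structure SigmaTranslation where
  /-- The map `σ^E`. -/
  map : E ≃ₗ[ℂ] Eσ
  map_smul : ∀ (a : A) (ξ : E), map (MulOpposite.op a • ξ) = MulOpposite.op (S.σ a) • map ξ

variable {S E Eσ}

/-- A `σ`-Hermitian structure: a Hermitian metric on `E` and an isomorphism `𝔰 : E^σ → E` of right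
modules with `(ξ₁, 𝔰σ^E(ξ₂)) = σ[(𝔰σ^E(ξ₁), ξ₂)]`. -/
structure SigmaHermitianStructure (τ : SigmaTranslation S E Eσ) where
  /-- The Hermitian metric on `E`. -/
  metric : HermitianMetric S E
  /-- The isomorphism `𝔰`. -/
  s : Eσ ≃ₗ[Aᵐᵒᵖ] E
  compat : ∀ ξ₁ ξ₂ : E,
    metric.pair ξ₁ (s (τ.map ξ₂)) = S.σ (metric.pair (s (τ.map ξ₁)) ξ₂)

/-- A `σ`-connection `∇ : E → E^σ ⊗_A Ω¹_{D,σ}(A)`, a `ℂ`-linear map with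
`∇(ξa) = (∇ξ)a + σ^E(ξ) ⊗ d_σ a`. -/
structure SigmaConnection (τ : SigmaTranslation S E Eσ) where
  /-- The map `∇`. -/
  nabla : E →ₗ[ℂ] BalancedTensor Eσ S.ρΩ
  leibniz : ∀ (ξ : E) (a : A), nabla (MulOpposite.op a • ξ) =
    BalancedTensor.mapRight S.ρΩ S.ρΩ (S.rightΩ a)
      (fun _ _ => Subtype.ext (mul_assoc _ _ _)) (nabla ξ) +
    BalancedTensor.tmul S.ρΩ (τ.map ξ) (S.dΩ a)

/-! ### The space `H(E)` with its inner product and its grading -/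

namespace HermitianMetric

variable (h : HermitianMetric S E)

theorem smul_left_complex (c : ℂ) (ξ η : E) : h.pair (c • ξ) η = conj c • h.pair ξ η := by
  have h1 : c • ξ = MulOpposite.op (algebraMap ℂ A c) • ξ := by
    rw [← MulOpposite.algebraMap_apply, algebraMap_smul]
  rw [h1, h.smul_left, ← algebraMap_star_comm, Algebra.smul_def]
  rfl

/-- The Hermitian inner product of `H(E) = E ⊗_A H`, antilinear in the first variable, with
`⟨ξ₁ ⊗ ζ₁, ξ₂ ⊗ ζ₂⟩ = ⟨ζ₁, (ξ₁, ξ₂)ζ₂⟩`. -/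
def innerHE : BalancedTensor E S.ρH →ₗ⋆[ℂ] BalancedTensor E S.ρH →ₗ[ℂ] ℂ :=
  BalancedTensor.lift S.ρH
    (LinearMap.mk₂'ₛₗ (starRingEnd ℂ) (starRingEnd ℂ)
      (fun ξ ζ => (innerₛₗ ℂ ζ) ∘ₗ BalancedTensor.contract S.ρH (h.pair ξ))
      (fun ξ ξ' ζ => by
        refine LinearMap.ext fun u => ?_
        induction u using BalancedTensor.induction with
        | ht η m => simp [h.add_left, inner_add_right]
        | hadd u v hu hv => rw [map_add, map_add, hu, hv])
      (fun c ξ ζ => by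
        refine LinearMap.ext fun u => ?_
        induction u using BalancedTensor.induction with
        | ht η m => simp [h.smul_left_complex, inner_smul_right]
        | hadd u v hu hv => rw [map_add, map_add, hu, hv])
      (fun ξ ζ ζ' => by refine LinearMap.ext fun u => ?_; simp)
      (fun c ξ ζ => by refine LinearMap.ext fun u => ?_; simp))
    (fun ξ a ζ => by
      refine LinearMap.ext fun u => ?_
      induction u using BalancedTensor.induction with
      | ht η m =>
        simp [h.smul_left, map_star, ContinuousLinearMap.star_eq_adjoint,
          ContinuousLinearMap.adjoint_inner_right]
      | hadd u v hu hv => rw [map_add, map_add, hu, hv])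

theorem innerHE_tmul (ξ₁ ξ₂ : E) (ζ₁ ζ₂ : H) :
    h.innerHE (BalancedTensor.tmul S.ρH ξ₁ ζ₁) (BalancedTensor.tmul S.ρH ξ₂ ζ₂) =
      ⟪ζ₁, S.rep (h.pair ξ₁ ξ₂) ζ₂⟫_ℂ :=
  rfl

end HermitianMetric

variable (S E) in
/-- The graded components `H^±(E) = E ⊗_A H^±`, as subspaces of `H(E)`. -/
def gradedHE (i : ZMod 2) : Submodule ℂ (BalancedTensor E S.ρH) :=
  Submodule.span ℂ {u | ∃ (ξ : E) (ζ : H), ζ ∈ S.gr i ∧ u = BalancedTensor.tmul S.ρH ξ ζ}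

variable (S E) in
/-- The components `E ⊗_A dom D^±`, with `dom D^± = dom D ∩ H^±`, as subspaces of `H(E)`. -/
def gradedDomain (i : ZMod 2) : Submodule ℂ (BalancedTensor E S.ρH) :=
  Submodule.span ℂ {u | ∃ (ξ : E) (ζ : H), ζ ∈ S.D.domain ∧ ζ ∈ S.gr i ∧
    u = BalancedTensor.tmul S.ρH ξ ζ}

/-! ### Pairings defined by `𝔰`, `𝔰`-adjoint, `σ`-Hermitian connections -/

namespace SigmaHermitianStructure

variable {τ : SigmaTranslation S E Eσ} (h : SigmaHermitianStructure τ)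

/-- `S = 𝔰 ⊗ 1_H : H(E^σ) → H(E)`. -/
def sH : BalancedTensor Eσ S.ρH →ₗ[ℂ] BalancedTensor E S.ρH :=
  BalancedTensor.mapLeft S.ρH (h.s : Eσ →ₗ[Aᵐᵒᵖ] E)

/-- The operator `T` is densely defined for the norm `‖u‖² = ⟨u, u⟩` of `H(E)`. -/
def IsDenselyDefined (T : BalancedTensor E S.ρH →ₗ.[ℂ] BalancedTensor Eσ S.ρH) : Prop :=
  ∀ (u : BalancedTensor E S.ρH) (ε : ℝ), 0 < ε →
    ∃ v ∈ T.domain, (h.metric.innerHE (u - v) (u - v)).re < ε ^ 2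

/-- The graph of the `𝔰`-adjoint `T^†`: the pairs `(x, y)` in `H(E) × H(E^σ)` such that
`⟨x, (𝔰 ⊗ 1)Tz⟩ = ⟨(𝔰 ⊗ 1)y, z⟩` for all `z` in the domain of `T`. -/
def sAdjointGraph (T : BalancedTensor E S.ρH →ₗ.[ℂ] BalancedTensor Eσ S.ρH) :
    Set (BalancedTensor E S.ρH × BalancedTensor Eσ S.ρH) :=
  {p | ∀ z : T.domain, h.metric.innerHE p.1 (h.sH (T z)) = h.metric.innerHE (h.sH p.2) z}

/-- `T` is `𝔰`-selfadjoint: it is densely defined and `T = T^†`, i.e. both have the same graph. -/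
def IsSSelfAdjoint (T : BalancedTensor E S.ρH →ₗ.[ℂ] BalancedTensor Eσ S.ρH) : Prop :=
  h.IsDenselyDefined T ∧
    (T.graph : Set (BalancedTensor E S.ρH × BalancedTensor Eσ S.ρH)) = h.sAdjointGraph T

/-- The pairing of `ξ ∈ E` with `E^σ ⊗_A Ω¹`, with operator values:
`(ξ, η ⊗ ω) ↦ (ξ, 𝔰η)ω`. -/
def pairRight (ξ : E) : BalancedTensor Eσ S.ρΩ →ₗ[ℂ] (H →L[ℂ] H) :=
  BalancedTensor.lift S.ρΩ
    (LinearMap.mk₂ ℂ (fun (η : Eσ) (ω : S.Ω) => S.rep (h.metric.pair ξ (h.s η)) * ω)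
      (fun η η' ω => by simp [add_mul])
      (fun c η ω => by
        rw [← smul_mul_assoc, ← map_smul]
        congr 2
        exact map_smul (((h.metric.pair ξ) ∘ₗ (h.s : Eσ →ₗ[Aᵐᵒᵖ] E)).restrictScalars ℂ) c η)
      (fun η ω ω' => by simp [mul_add])
      (fun c η ω => by simp))
    (fun η a ω => by simp [mul_assoc])

/-- The pairing of `E^σ ⊗_A Ω¹` with `ζ ∈ E`, with operator values, antilinear in the first
variable: `(η ⊗ ω, ζ) ↦ ω^* (𝔰η, ζ)`. -/
def pairLeft (ζ : E) : BalancedTensor Eσ S.ρΩ →ₗ⋆[ℂ] (H →L[ℂ] H) :=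
  BalancedTensor.lift S.ρΩ
    (LinearMap.mk₂'ₛₗ (starRingEnd ℂ) (starRingEnd ℂ)
      (fun (η : Eσ) (ω : S.Ω) =>
        star (ω : H →L[ℂ] H) * S.rep (h.metric.pair (h.s η) ζ))
      (fun η η' ω => by simp [h.metric.add_left, mul_add])
      (fun c η ω => by
        have : h.s (c • η) = c • h.s η :=
          map_smul ((h.s : Eσ →ₗ[Aᵐᵒᵖ] E).restrictScalars ℂ) c η
        rw [this, h.metric.smul_left_complex, map_smul, mul_smul_comm])
      (fun η ω ω' => by simp [add_mul])
      (fun c η ω => by simp))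
    (fun η a ω => by simp [h.metric.smul_left, mul_assoc, map_star])

/-- The `σ`-connection `∇` is `σ`-Hermitian:
`(ξ, 𝔰∇η) - (𝔰∇ξ, η) = d_σ (𝔰σ^E(ξ), η)`. -/
def IsSigmaHermitian (c : SigmaConnection τ) : Prop :=
  ∀ ξ η : E, h.pairRight ξ (c.nabla η) - h.pairLeft η (c.nabla ξ) =
    S.d (h.metric.pair (h.s (τ.map ξ)) η)

end SigmaHermitianStructure

/-! ### Coupled operators -/

namespace SigmaConnection

variable {τ : SigmaTranslation S E Eσ} (c : SigmaConnection τ)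

variable (S Eσ) in
/-- The map `(ζ, η ⊗ ω) ↦ η ⊗ ω(ζ)`. -/
def evalΩ : H →ₗ[ℂ] BalancedTensor Eσ S.ρΩ →ₗ[ℂ] BalancedTensor Eσ S.ρH where
  toFun ζ := BalancedTensor.mapRight S.ρΩ S.ρH
    ((ContinuousLinearMap.apply ℂ H ζ : (H →L[ℂ] H) →ₗ[ℂ] H) ∘ₗ S.Ω.subtype) (fun _ _ => rfl)
  map_add' ζ ζ' := by
    refine LinearMap.ext fun u => ?_
    induction u using BalancedTensor.induction with
    | ht η m =>
      change BalancedTensor.tmul S.ρH η ((m : H →L[ℂ] H) (ζ + ζ')) =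
        BalancedTensor.tmul S.ρH η ((m : H →L[ℂ] H) ζ) +
          BalancedTensor.tmul S.ρH η ((m : H →L[ℂ] H) ζ')
      simp [BalancedTensor.tmul]
    | hadd u v hu hv =>
      exact (LinearMap.map_add _ u v).trans
        ((congrArg₂ _ hu hv).trans (LinearMap.map_add _ u v).symm)
  map_smul' a ζ := by
    refine LinearMap.ext fun u => ?_
    induction u using BalancedTensor.induction with
    | ht η m =>
      change BalancedTensor.tmul S.ρH η ((m : H →L[ℂ] H) (a • ζ)) =
        a • BalancedTensor.tmul S.ρH η ((m : H →L[ℂ] H) ζ)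
      simp [BalancedTensor.tmul]
    | hadd u v hu hv =>
      exact (LinearMap.map_add _ u v).trans
        ((congrArg₂ _ hu hv).trans (LinearMap.map_add _ u v).symm)

theorem evalΩ_tmul (ζ : H) (η : Eσ) (ω : S.Ω) :
    evalΩ S Eσ ζ (BalancedTensor.tmul S.ρΩ η ω) =
      BalancedTensor.tmul S.ρH η ((ω : H →L[ℂ] H) ζ) :=
  rfl

theorem evalΩ_rep (a : A) (ζ : H) (u : BalancedTensor Eσ S.ρΩ) :
    evalΩ S Eσ ζ (BalancedTensor.mapRight S.ρΩ S.ρΩ (S.rightΩ a)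
      (fun _ _ => Subtype.ext (mul_assoc _ _ _)) u) = evalΩ S Eσ (S.rep a ζ) u := by
  induction u using BalancedTensor.induction with
  | ht η m => simp [evalΩ_tmul]
  | hadd u v hu hv => rw [map_add, map_add, map_add, hu, hv]

/-- The map `E ⊗_A dom D → H(E^σ)`, `ξ ⊗ ζ ↦ σ^E(ξ) ⊗ Dζ + c(∇)(ξ ⊗ ζ)`, where
`c(∇)(ξ ⊗ ζ) = Σ ξ_α ⊗ ω_α(ζ)` if `∇ξ = Σ ξ_α ⊗ ω_α`. -/
def coupledMap : BalancedTensor E S.ρDom →ₗ[ℂ] BalancedTensor Eσ S.ρH :=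
  BalancedTensor.lift S.ρDom
    (LinearMap.mk₂ ℂ
      (fun (ξ : E) (ζ : S.D.domain) =>
        BalancedTensor.tmul S.ρH (τ.map ξ) (S.D ζ) + evalΩ S Eσ ζ (c.nabla ξ))
      (fun ξ ξ' ζ => by simp [BalancedTensor.tmul]; abel)
      (fun a ξ ζ => by simp [BalancedTensor.tmul])
      (fun ξ ζ ζ' => by simp [BalancedTensor.tmul, LinearPMap.map_add]; abel)
      (fun a ξ ζ => by simp [BalancedTensor.tmul, LinearPMap.map_smul]))
    (fun ξ a ζ => by
      simp only [LinearMap.mk₂_apply, τ.map_smul, c.leibniz, map_add, evalΩ_rep, evalΩ_tmul,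
        BalancedTensor.smul_tmul, TwistedSpectralTriple.ρH_apply,
        TwistedSpectralTriple.coe_ρDom_apply]
      have h1 : ((S.dΩ a : S.Ω) : H →L[ℂ] H) ζ =
          S.D (S.ρDom a ζ) - S.rep (S.σ a) (S.D ζ) := S.d_apply a ζ
      rw [h1]
      simp only [BalancedTensor.tmul, map_sub]
      abel)

theorem coupledMap_tmul (ξ : E) (ζ : S.D.domain) :
    c.coupledMap (BalancedTensor.tmul S.ρDom ξ ζ) =
      BalancedTensor.tmul S.ρH (τ.map ξ) (S.D ζ) + evalΩ S Eσ ζ (c.nabla ξ) :=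
  rfl

variable (S E) in
/-- The inclusion `E ⊗_A dom D → E ⊗_A H`. -/
def inclDomain : BalancedTensor E S.ρDom →ₗ[ℂ] BalancedTensor E S.ρH :=
  BalancedTensor.mapRight S.ρDom S.ρH S.D.domain.subtype (fun _ _ => rfl)

variable [Module.Finite Aᵐᵒᵖ E] [Module.Projective Aᵐᵒᵖ E]

variable (S E) in
theorem inclDomain_injective : Function.Injective (inclDomain S E) :=
  BalancedTensor.mapRight_injective _ _ _ _ S.D.domain.subtype_injective

/-- The coupled operator `D_∇` from `H(E)` to `H(E^σ)`, with domain `E ⊗_A dom D`. -/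
def coupledOperator : BalancedTensor E S.ρH →ₗ.[ℂ] BalancedTensor Eσ S.ρH where
  domain := LinearMap.range (inclDomain S E)
  toFun := c.coupledMap ∘ₗ
    (LinearEquiv.ofInjective (inclDomain S E) (inclDomain_injective S E)).symm.toLinearMap

theorem tmul_mem_domain (ξ : E) (ζ : H) (hζ : ζ ∈ S.D.domain) :
    BalancedTensor.tmul S.ρH ξ ζ ∈ c.coupledOperator.domain :=
  ⟨BalancedTensor.tmul S.ρDom ξ ⟨ζ, hζ⟩, rfl⟩

theorem coupledOperator_tmul (ξ : E) (ζ : H) (hζ : ζ ∈ S.D.domain) :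
    c.coupledOperator ⟨BalancedTensor.tmul S.ρH ξ ζ, c.tmul_mem_domain ξ ζ hζ⟩ =
      BalancedTensor.tmul S.ρH (τ.map ξ) (S.D ⟨ζ, hζ⟩) + evalΩ S Eσ ζ (c.nabla ξ) := by
  rw [← c.coupledMap_tmul ξ ⟨ζ, hζ⟩]
  change c.coupledMap _ = _
  congr 1
  exact (LinearEquiv.symm_apply_eq _).2 rfl

theorem gradedDomain_le (i : ZMod 2) : gradedDomain S E i ≤ c.coupledOperator.domain := by
  refine Submodule.span_le.2 ?_
  rintro _ ⟨ξ, ζ, hζ, -, rfl⟩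
  exact c.tmul_mem_domain ξ ζ hζ

theorem evalΩ_odd (i : ZMod 2) (ζ : H) (hζ : ζ ∈ S.gr i) (u : BalancedTensor Eσ S.ρΩ) :
    evalΩ S Eσ ζ u ∈ gradedHE S Eσ (i + 1) := by
  induction u using BalancedTensor.induction with
  | ht η m => exact Submodule.subset_span ⟨η, _, S.Ω_odd m m.2 i ζ hζ, rfl⟩
  | hadd u v hu hv => rw [map_add]; exact Submodule.add_mem _ hu hv

theorem coupledOperator_odd (i : ZMod 2) (u : gradedDomain S E i) :
    c.coupledOperator ⟨u, c.gradedDomain_le i u.2⟩ ∈ gradedHE S Eσ (i + 1) := by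
  obtain ⟨u, hu⟩ := u
  have key : ∀ hu' : u ∈ c.coupledOperator.domain,
      c.coupledOperator ⟨u, hu'⟩ ∈ gradedHE S Eσ (i + 1) := by
    induction hu using Submodule.span_induction with
    | mem x hx =>
      obtain ⟨ξ, ζ, hζ, hi, rfl⟩ := hx
      intro hu'
      rw [c.coupledOperator_tmul ξ ζ hζ]
      exact Submodule.add_mem _ (Submodule.subset_span ⟨_, _, S.D_odd i ⟨ζ, hζ⟩ hi, rfl⟩)
        (evalΩ_odd i ζ hi _)
    | zero =>
      intro hu'
      have : c.coupledOperator ⟨0, hu'⟩ = 0 := c.coupledOperator.map_zero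
      rw [this]
      exact Submodule.zero_mem _
    | add x y hx hy hx' hy' =>
      intro hu'
      have h1 := c.gradedDomain_le i hx
      have h2 := c.gradedDomain_le i hy
      have : c.coupledOperator ⟨x + y, hu'⟩ =
          c.coupledOperator ⟨x, h1⟩ + c.coupledOperator ⟨y, h2⟩ :=
        c.coupledOperator.map_add ⟨x, h1⟩ ⟨y, h2⟩
      rw [this]
      exact Submodule.add_mem _ (hx' h1) (hy' h2)
    | smul a x hx hx' =>
      intro hu'
      have h1 := c.gradedDomain_le i hx
      have : c.coupledOperator ⟨a • x, hu'⟩ = a • c.coupledOperator ⟨x, h1⟩ :=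
        c.coupledOperator.map_smul a ⟨x, h1⟩
      rw [this]
      exact Submodule.smul_mem _ _ (hx' h1)
  exact key _

/-- The operators `D_∇^± : E ⊗_A dom D^± → H^∓(E^σ)`. -/
def coupledOperatorGr (i : ZMod 2) : gradedDomain S E i →ₗ[ℂ] gradedHE S Eσ (i + 1) :=
  LinearMap.codRestrict _
    (c.coupledOperator.toFun ∘ₗ Submodule.inclusion (c.gradedDomain_le i))
    (c.coupledOperator_odd i)

end SigmaConnection

end Modules

end

set_option linter.unusedSectionVars false

/-! Selfadjointness. On elementary tensors, the `σ`-Hermitian identity together with `compat` and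
the symmetry of `D` gives `⟨u, 𝔰D_∇v⟩ = ⟨𝔰D_∇u, v⟩` (`inner_coupledMap_symm`). Conversely, let `(x,
y)` lie in the graph of the `𝔰`-adjoint. Then `ζ ↦ ⟨x, 𝔰σ^E(ξ) ⊗ Dζ⟩` is a bounded functional of
`ζ`, because the term of `∇` and the pairing with `𝔰y` are bounded. So the coefficient of `x` along
`𝔰σ^E(ξ)` lies in `dom D^* = dom D`. As `𝔰σ^E` is onto, this holds for all coefficients of `x` in a
dual basis, hence `x ∈ E ⊗ dom D`, and nondegeneracy of the form yields `y = D_∇x`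
(`isSSelfAdjoint_coupledOperator`).

Cokernels. Generators `e_j` of `E^σ` give a surjection `Hⁿ → H(E^σ)`. Applying `D_∇` to
`(σ^E)⁻¹(e_j) ⊗ (D+i)⁻¹x_j` shows that `ran D_∇` contains the image of `ran (1 + K)` with `K`
compact (`exists_parametrix`). So `ran D_∇` has finite codimension, and every linear functional that
vanishes on it is automatically continuous (`range_one_add`). By Riesz such a functional is `y ↦ ⟨x,
𝔰y⟩`; since `(x, 0)` is then in the graph of the `𝔰`-adjoint, `x ∈ ker D_∇`. The projections onto
the graded components turn this into a nondegenerate pairing of `ker D_∇^∓` with the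
finite-dimensional `coker D_∇^±`, whence the isomorphisms (`nonempty_coker_equiv_ker`). The only
topologies involved are those of `H` and `Hⁿ`; neither a norm on `H(E)` nor a closed range theorem
is needed. -/

noncomputable section

/-! ### Compact perturbations of the identity -/

namespace IsCompactOperator

variable {X : Type*} [NormedAddCommGroup X] [InnerProductSpace ℂ X] [CompleteSpace X]

/-- A compact operator `K` on a Hilbert space is close to `P K` for the orthogonal projection `P`
onto a suitable finite-dimensional subspace. -/
theorem exists_finiteDimensional_norm_sub_lt {K : X →L[ℂ] X} (hK : IsCompactOperator K) :
    ∃ F : Submodule ℂ X, ∃ _ : FiniteDimensional ℂ F, ‖K - F.starProjection ∘L K‖ < 1 := by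
  obtain ⟨C, hC, hKC⟩ := hK.image_closedBall_subset_compact 1
  -- A finite `1/2`-net of the image of the unit ball; `F` is its span. Any radius below `1` would
  -- do.
  obtain ⟨t, -, ht, hCt⟩ := hC.finite_cover_balls (e := 1 / 2) (by norm_num)
  have hF : FiniteDimensional ℂ (Submodule.span ℂ t) := FiniteDimensional.span_of_finite ℂ ht
  refine ⟨Submodule.span ℂ t, hF, lt_of_le_of_lt (ContinuousLinearMap.opNorm_le_of_unit_norm
    (C := 1 / 2) (by norm_num) fun x hx => ?_) (by norm_num)⟩
  obtain ⟨y, hy, hxy⟩ := Set.mem_iUnion₂.1 (hCt (hKC ⟨x, by simp [hx], rfl⟩))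
  rw [Metric.mem_ball, dist_eq_norm] at hxy
  change ‖K x - (Submodule.span ℂ t).starProjection (K x)‖ ≤ 1 / 2
  -- The projection realizes the distance to `F`, which is at most the distance to the net point
  -- `y`.
  rw [Submodule.starProjection_minimal]
  refine (ciInf_le ⟨0, ?_⟩ (⟨y, Submodule.subset_span hy⟩ : Submodule.span ℂ t)).trans hxy.le
  rintro _ ⟨z, rfl⟩
  exact norm_nonneg _

/-- The range of `1 + K` has finite codimension for `K` compact, and linear functionals that
vanish on it are automatically continuous. -/
theorem range_one_add {K : X →L[ℂ] X} (hK : IsCompactOperator K) :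
    (∃ F : Submodule ℂ X, FiniteDimensional ℂ F ∧ ∀ x, ∃ u, ∃ f ∈ F, x = u + K u + f) ∧
    ∀ f : X →ₗ[ℂ] ℂ, (∀ x, f (x + K x) = 0) → Continuous f := by
  obtain ⟨F, hF, hlt⟩ := hK.exists_finiteDimensional_norm_sub_lt
  have hlt' : ‖-(K - F.starProjection ∘L K)‖ < 1 := by rwa [norm_neg]
  -- `U = 1 + K - PK` is invertible by the Neumann series, so `x = (1 + K)U⁻¹x - PKU⁻¹x`.
  let U : (X →L[ℂ] X)ˣ := Units.oneSub _ hlt'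
  have hU : ∀ x, x = (U⁻¹ : (X →L[ℂ] X)ˣ).1 x + K ((U⁻¹ : (X →L[ℂ] X)ˣ).1 x) -
      F.starProjection (K ((U⁻¹ : (X →L[ℂ] X)ˣ).1 x)) := by
    intro x
    have h := congrArg (fun T : X →L[ℂ] X => T x) U.mul_inv
    have h2 : (U : X →L[ℂ] X) = 1 - -(K - F.starProjection ∘L K) := rfl
    rw [h2] at h
    simp at h
    rw [sub_sub_eq_add_sub] at h
    exact h.symm
  refine ⟨⟨F, hF, fun x => ⟨_, -F.starProjection (K ((U⁻¹ : (X →L[ℂ] X)ˣ).1 x)),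
    F.neg_mem (F.starProjection_apply_mem _), by rw [← sub_eq_add_neg]; exact hU x⟩⟩,
    fun f hf => ?_⟩
  -- If `f` kills `ran (1 + K)`, then `f(x) = -f(PKU⁻¹x)`, which involves `f` only on the
  -- finite-dimensional `F`.
  have hc : Continuous (f ∘ₗ F.subtype) := LinearMap.continuous_of_finiteDimensional _
  have hfe : ⇑f = fun x => -(f ∘ₗ F.subtype)
      (F.orthogonalProjectionOnto (K ((U⁻¹ : (X →L[ℂ] X)ˣ).1 x))) := by
    funext x
    conv_lhs => rw [hU x]
    rw [map_sub, hf, zero_sub]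
    rfl
  rw [hfe]
  fun_prop

end IsCompactOperator

/-! ### Dual bases and expansions in balanced tensor products -/

namespace BalancedTensor

variable {A : Type*} [Ring A] [Algebra ℂ A]
  {M : Type*} [AddCommGroup M] [Module ℂ M]
  {E : Type*} [AddCommGroup E] [Module ℂ E] [Module Aᵐᵒᵖ E] [IsScalarTower ℂ Aᵐᵒᵖ E]

/-- A finitely generated projective module is a retract of a free one: `e_j` are the images of the
standard basis vectors and `φ_j` the coordinates of the section. -/
theorem exists_dualBasis (E : Type*) [AddCommGroup E] [Module Aᵐᵒᵖ E] [Module.Finite Aᵐᵒᵖ E]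
    [Module.Projective Aᵐᵒᵖ E] : ∃ (n : ℕ) (e : Fin n → E) (φ : Fin n → (E →ₗ[Aᵐᵒᵖ] A)),
    ∀ ξ : E, ξ = ∑ j, MulOpposite.op (φ j ξ) • e j := by
  obtain ⟨n, f, k, -, -, hfk⟩ := Module.Finite.exists_comp_eq_id_of_projective Aᵐᵒᵖ E
  let unopLin : Aᵐᵒᵖ →ₗ[Aᵐᵒᵖ] A :=
    { toFun := MulOpposite.unop, map_add' := fun _ _ => rfl, map_smul' := fun _ _ => rfl }
  refine ⟨n, fun j => f (Pi.single j 1), fun j => unopLin ∘ₗ (LinearMap.proj j) ∘ₗ k, fun ξ => ?_⟩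
  have hk : k ξ = ∑ j, k ξ j • Pi.single j (1 : Aᵐᵒᵖ) := by
    funext i
    simp [Finset.sum_apply, Pi.single_apply]
  have h1 : f (k ξ) = ξ := LinearMap.congr_fun hfk ξ
  conv_lhs => rw [← h1, hk, map_sum]
  exact Finset.sum_congr rfl fun j _ => map_smul f (k ξ j) _

theorem tmul_add (ρ : A →ₐ[ℂ] Module.End ℂ M) (ξ : E) (m m' : M) :
    tmul ρ ξ (m + m') = tmul ρ ξ m + tmul ρ ξ m' :=
  map_add (tmulHom E ρ ξ) m m'

theorem sum_tmul {ι : Type*} (s : Finset ι) (ρ : A →ₐ[ℂ] Module.End ℂ M) (ξ : ι → E) (m : M) :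
    tmul ρ (∑ j ∈ s, ξ j) m = ∑ j ∈ s, tmul ρ (ξ j) m := by
  simp only [tmul, map_sum, LinearMap.sum_apply]

/-- The expansion of an element of `E ⊗_A M` in a dual basis. -/
theorem eq_sum_tmul_contract (ρ : A →ₐ[ℂ] Module.End ℂ M) {n : ℕ} {e : Fin n → E}
    {φ : Fin n → (E →ₗ[Aᵐᵒᵖ] A)} (hE : ∀ ξ : E, ξ = ∑ j, MulOpposite.op (φ j ξ) • e j)
    (u : BalancedTensor E ρ) : u = ∑ j, tmul ρ (e j) (contract ρ (φ j) u) := by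
  induction u using BalancedTensor.induction with
  | ht ξ m =>
    conv_lhs => rw [hE ξ, sum_tmul]
    simp only [contract_tmul, ← smul_tmul]
  | hadd u v hu hv =>
    conv_lhs => rw [hu, hv]
    rw [← Finset.sum_add_distrib]
    exact Finset.sum_congr rfl fun j _ => by rw [map_add, tmul_add]

theorem hom_ext {τ : ℂ →+* ℂ} {P : Type*} [AddCommGroup P] [Module ℂ P]
    {ρ : A →ₐ[ℂ] Module.End ℂ M} {f g : BalancedTensor E ρ →ₛₗ[τ] P}
    (h : ∀ ξ m, f (tmul ρ ξ m) = g (tmul ρ ξ m)) : f = g := by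
  refine LinearMap.ext fun u => ?_
  induction u using BalancedTensor.induction with
  | ht ξ m => exact h ξ m
  | hadd u v hu hv => rw [map_add, map_add, hu, hv]

end BalancedTensor

/-! ### The Hermitian form of `H(E)` -/

section Modules

variable {A : Type*} [Ring A] [StarRing A] [Algebra ℂ A] [StarModule ℂ A]
  {H : Type*} [NormedAddCommGroup H] [InnerProductSpace ℂ H] [CompleteSpace H]
  {S : TwistedSpectralTriple A H}
  {E : Type*} [AddCommGroup E] [Module ℂ E] [Module Aᵐᵒᵖ E] [IsScalarTower ℂ Aᵐᵒᵖ E]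
  {Eσ : Type*} [AddCommGroup Eσ] [Module ℂ Eσ] [Module Aᵐᵒᵖ Eσ] [IsScalarTower ℂ Aᵐᵒᵖ Eσ]

namespace HermitianMetric

variable (h : HermitianMetric S E)

theorem pair_smul_complex (c : ℂ) (ξ η : E) : h.pair ξ (c • η) = c • h.pair ξ η :=
  map_smul ((h.pair ξ).restrictScalars ℂ) c η

/-- Polarization: `(ξ, ξ)` acts as a selfadjoint operator, and this is applied to `ξ + η` and `ξ +
iη`. The symmetry is one of operators, not of elements of `A`, because positivity is a condition on
operators and `S.rep` need not be injective. -/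
theorem star_rep_pair (ξ η : E) : star (S.rep (h.pair ξ η)) = S.rep (h.pair η ξ) := by
  have hsa : ∀ ξ, star (S.rep (h.pair ξ ξ)) = S.rep (h.pair ξ ξ) := fun ξ =>
    (h.pos ξ).isSelfAdjoint
  have h1 := hsa (ξ + η)
  have h2 := hsa (ξ + Complex.I • η)
  simp only [h.add_left, h.smul_left_complex, h.pair_smul_complex, map_add, star_add, hsa ξ,
    hsa η, map_smul, star_smul, Complex.conj_I, smul_add, smul_smul] at h1 h2
  simp only [RCLike.star_def, Complex.conj_I, map_neg, map_mul, neg_neg] at h2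
  have h3 : star (S.rep (h.pair ξ η)) + star (S.rep (h.pair η ξ)) =
      S.rep (h.pair ξ η) + S.rep (h.pair η ξ) := by
    linear_combination (norm := module) h1
  have h4 : -Complex.I • star (S.rep (h.pair ξ η)) + Complex.I • star (S.rep (h.pair η ξ)) =
      Complex.I • S.rep (h.pair ξ η) - Complex.I • S.rep (h.pair η ξ) := by
    linear_combination (norm := module) h2
  have h5 : star (S.rep (h.pair ξ η)) - star (S.rep (h.pair η ξ)) =
      -(S.rep (h.pair ξ η) - S.rep (h.pair η ξ)) := by
    have := congrArg (fun T => Complex.I • T) h4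
    simp only [smul_add, smul_sub, smul_smul, mul_neg, Complex.I_mul_I] at this
    linear_combination (norm := module) this
  have h6 : (2 : ℂ) • star (S.rep (h.pair ξ η)) = (2 : ℂ) • S.rep (h.pair η ξ) := by
    linear_combination (norm := module) h3 + h5
  exact smul_right_injective _ two_ne_zero h6

theorem innerHE_tmul_left (ξ : E) (ζ : H) (u : BalancedTensor E S.ρH) :
    h.innerHE (BalancedTensor.tmul S.ρH ξ ζ) u =
      ⟪ζ, BalancedTensor.contract S.ρH (h.pair ξ) u⟫_ℂ :=
  rfl

theorem conj_innerHE (u v : BalancedTensor E S.ρH) :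
    conj (h.innerHE u v) = h.innerHE v u := by
  induction u using BalancedTensor.induction with
  | ht ξ m =>
    induction v using BalancedTensor.induction with
    | ht η k =>
      rw [innerHE_tmul, innerHE_tmul, inner_conj_symm, ← h.star_rep_pair,
        ContinuousLinearMap.star_eq_adjoint, ContinuousLinearMap.adjoint_inner_left]
    | hadd u v hu hv => rw [map_add, map_add, map_add, LinearMap.add_apply, hu, hv]
  | hadd u w hu hw => rw [map_add, LinearMap.add_apply, map_add, map_add, hu, hw]

theorem innerHE_tmul_right (ξ : E) (ζ : H) (u : BalancedTensor E S.ρH) :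
    h.innerHE u (BalancedTensor.tmul S.ρH ξ ζ) =
      ⟪BalancedTensor.contract S.ρH (h.pair ξ) u, ζ⟫_ℂ := by
  rw [← conj_innerHE, innerHE_tmul_left, inner_conj_symm]

variable [Module.Finite Aᵐᵒᵖ E] [Module.Projective Aᵐᵒᵖ E]

theorem exists_dualBasis : ∃ (n : ℕ) (e η : Fin n → E),
    ∀ ξ : E, ξ = ∑ j, MulOpposite.op (h.pair (η j) ξ) • e j := by
  obtain ⟨n, e, φ, hφ⟩ := BalancedTensor.exists_dualBasis (A := A) E
  -- By nondegeneracy of the metric, the coordinate functionals are themselves of the form `(η_j,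
  -- ·)`.
  choose η hη using fun j => h.nondegenerate.2 (φ j)
  exact ⟨n, e, η, fun ξ => by simpa only [hη] using hφ ξ⟩

theorem eq_zero_of_contract (u : BalancedTensor E S.ρH)
    (hu : ∀ ξ, BalancedTensor.contract S.ρH (h.pair ξ) u = 0) : u = 0 := by
  obtain ⟨n, e, η, hE⟩ := h.exists_dualBasis
  rw [BalancedTensor.eq_sum_tmul_contract S.ρH hE u]
  simp [hu, BalancedTensor.tmul]

/-- The Hermitian form is nondegenerate, even when tested on a dense subspace of `H`. -/
theorem eq_zero_of_innerHE {V : Submodule ℂ H} (hV : Dense (V : Set H))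
    (u : BalancedTensor E S.ρH)
    (hu : ∀ ξ, ∀ ζ ∈ V, h.innerHE u (BalancedTensor.tmul S.ρH ξ ζ) = 0) : u = 0 := by
  refine h.eq_zero_of_contract u fun ξ => hV.eq_zero_of_inner_left ℂ fun ζ hζ => ?_
  rw [← innerHE_tmul_right]
  exact hu ξ ζ hζ

/-- Riesz representation: the separately continuous functionals are those given by the form. -/
theorem exists_innerHE_eq (f : BalancedTensor E S.ρH →ₗ[ℂ] ℂ)
    (hf : ∀ ξ : E, Continuous fun ζ => f (BalancedTensor.tmul S.ρH ξ ζ)) :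
    ∃ x, ∀ y, h.innerHE x y = f y := by
  obtain ⟨n, e, η, hE⟩ := h.exists_dualBasis
  -- With `y = Σ e_j ⊗ (η_j, y)`, `f(y) = Σ F(e_j)((η_j, y))`; the Riesz vectors of the `F(e_j)`,
  -- tensored with `η_j`, therefore represent `f`.
  let F : E → StrongDual ℂ H := fun ξ =>
    ⟨f ∘ₗ BalancedTensor.tmulHom E S.ρH ξ, hf ξ⟩
  refine ⟨∑ j, BalancedTensor.tmul S.ρH (η j) ((InnerProductSpace.toDual ℂ H).symm (F (e j))),
    fun y => ?_⟩
  conv_rhs => rw [BalancedTensor.eq_sum_tmul_contract S.ρH hE y, map_sum]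
  rw [map_sum, LinearMap.sum_apply]
  refine Finset.sum_congr rfl fun j _ => ?_
  rw [innerHE_tmul_left, InnerProductSpace.toDual_symm_apply]
  rfl

end HermitianMetric

end Modules

/-! ### `𝔰`-selfadjointness of the coupled operator -/

namespace TwistedSpectralTriple

variable {A : Type*} [Ring A] [StarRing A] [Algebra ℂ A] [StarModule ℂ A]
  {H : Type*} [NormedAddCommGroup H] [InnerProductSpace ℂ H] [CompleteSpace H]
  (S : TwistedSpectralTriple A H)

theorem D_symmetric (x y : S.D.domain) : ⟪S.D x, (y : H)⟫_ℂ = ⟪(x : H), S.D y⟫_ℂ := by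
  have h := LinearPMap.adjoint_isFormalAdjoint (T := S.D) S.isSelfAdjoint_D.dense_domain
  rw [LinearPMap.isSelfAdjoint_def.1 S.isSelfAdjoint_D] at h
  exact h x y

theorem mem_domain_of_inner (x w : H) (hx : ∀ z : S.D.domain, ⟪x, S.D z⟫_ℂ = ⟪w, (z : H)⟫_ℂ) :
    x ∈ S.D.domain := by
  have h := LinearPMap.mem_adjoint_domain_of_exists (T := S.D) x ⟨w, fun z => (hx z).symm⟩
  rwa [LinearPMap.isSelfAdjoint_def.1 S.isSelfAdjoint_D] at h

end TwistedSpectralTriple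

section Modules

variable {A : Type*} [Ring A] [StarRing A] [Algebra ℂ A] [StarModule ℂ A]
  {H : Type*} [NormedAddCommGroup H] [InnerProductSpace ℂ H] [CompleteSpace H]
  {S : TwistedSpectralTriple A H}
  {E : Type*} [AddCommGroup E] [Module ℂ E] [Module Aᵐᵒᵖ E] [IsScalarTower ℂ Aᵐᵒᵖ E]
  {Eσ : Type*} [AddCommGroup Eσ] [Module ℂ Eσ] [Module Aᵐᵒᵖ Eσ] [IsScalarTower ℂ Aᵐᵒᵖ Eσ]

namespace SigmaHermitianStructure

variable {τ : SigmaTranslation S E Eσ} (h : SigmaHermitianStructure τ)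

theorem sH_tmul (θ : Eσ) (ζ : H) :
    h.sH (BalancedTensor.tmul S.ρH θ ζ) = BalancedTensor.tmul S.ρH (h.s θ) ζ :=
  rfl

/-- The inverse of `𝔰 ⊗ 1_H`. -/
def sHInv : BalancedTensor E S.ρH →ₗ[ℂ] BalancedTensor Eσ S.ρH :=
  BalancedTensor.mapLeft S.ρH (h.s.symm : E →ₗ[Aᵐᵒᵖ] Eσ)

theorem sHInv_tmul (ξ : E) (ζ : H) :
    h.sHInv (BalancedTensor.tmul S.ρH ξ ζ) = BalancedTensor.tmul S.ρH (h.s.symm ξ) ζ :=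
  rfl

theorem sHInv_sH (y : BalancedTensor Eσ S.ρH) : h.sHInv (h.sH y) = y :=
  LinearMap.congr_fun (BalancedTensor.hom_ext (f := h.sHInv ∘ₗ h.sH) (g := LinearMap.id)
    fun θ ζ => by simp [sH_tmul, sHInv_tmul]) y

theorem sH_sHInv (x : BalancedTensor E S.ρH) : h.sH (h.sHInv x) = x :=
  LinearMap.congr_fun (BalancedTensor.hom_ext (f := h.sH ∘ₗ h.sHInv) (g := LinearMap.id)
    fun ξ ζ => by simp [sH_tmul, sHInv_tmul]) x

open SigmaConnection in
theorem contract_sH_evalΩ (ξ : E) (ζ : H) (w : BalancedTensor Eσ S.ρΩ) :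
    BalancedTensor.contract S.ρH (h.metric.pair ξ) (h.sH (evalΩ S Eσ ζ w)) =
      h.pairRight ξ w ζ := by
  induction w using BalancedTensor.induction with
  | ht θ ω => rfl
  | hadd u v hu hv => rw [map_add, map_add, map_add, map_add, hu, hv]; rfl

open SigmaConnection in
theorem innerHE_sH_evalΩ_left (η : E) (ζ ζ' : H) (w : BalancedTensor Eσ S.ρΩ) :
    h.metric.innerHE (h.sH (evalΩ S Eσ ζ w)) (BalancedTensor.tmul S.ρH η ζ') =
      ⟪ζ, h.pairLeft η w ζ'⟫_ℂ := by
  induction w using BalancedTensor.induction with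
  | ht θ ω =>
    rw [evalΩ_tmul, sH_tmul, HermitianMetric.innerHE_tmul]
    change _ = ⟪ζ, star (ω : H →L[ℂ] H) (S.rep (h.metric.pair (h.s θ) η) ζ')⟫_ℂ
    rw [ContinuousLinearMap.star_eq_adjoint, ContinuousLinearMap.adjoint_inner_right]
  | hadd u v hu hv =>
    rw [map_add, map_add, map_add, map_add, LinearMap.add_apply, hu, hv,
      add_apply, inner_add_right]

-- Boundedness of the connection term: its pairing with a fixed `x` is a bounded functional of `ζ`,
-- since one-forms are bounded operators and have adjoints.
open SigmaConnection in
theorem exists_innerHE_sH_evalΩ (x : BalancedTensor E S.ρH) (w : BalancedTensor Eσ S.ρΩ) :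
    ∃ v : H, ∀ ζ, h.metric.innerHE x (h.sH (evalΩ S Eσ ζ w)) = ⟪v, ζ⟫_ℂ := by
  induction w using BalancedTensor.induction with
  | ht θ ω =>
    refine ⟨ContinuousLinearMap.adjoint (ω : H →L[ℂ] H)
      (BalancedTensor.contract S.ρH (h.metric.pair (h.s θ)) x), fun ζ => ?_⟩
    rw [evalΩ_tmul, sH_tmul, HermitianMetric.innerHE_tmul_right,
      ContinuousLinearMap.adjoint_inner_left]
  | hadd u v hu hv =>
    obtain ⟨a, ha⟩ := hu
    obtain ⟨b, hb⟩ := hv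
    exact ⟨a + b, fun ζ => by rw [map_add, map_add, map_add, ha, hb, inner_add_left]⟩

end SigmaHermitianStructure

namespace SigmaConnection

variable {τ : SigmaTranslation S E Eσ} (c : SigmaConnection τ) (h : SigmaHermitianStructure τ)

/-- Put `a = (𝔰σ^E(ξ), ξ')`. By `compat` the terms containing `D` are `⟨ζ, σ(a)Dζ'⟩` on the left and
`⟨Dζ, aζ'⟩ = ⟨ζ, Daζ'⟩` on the right. Their discrepancy `d_σ a` is exactly what the `σ`-Hermitian
identity supplies from the terms containing `∇`. -/
theorem inner_coupledMap_symm (hc : h.IsSigmaHermitian c) (v w : BalancedTensor E S.ρDom) :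
    h.metric.innerHE (inclDomain S E v) (h.sH (c.coupledMap w)) =
      h.metric.innerHE (h.sH (c.coupledMap v)) (inclDomain S E w) := by
  induction v using BalancedTensor.induction with
  | hadd u v hu hv => simp only [map_add, LinearMap.add_apply, hu, hv]
  | ht ξ ζ =>
    induction w using BalancedTensor.induction with
    | hadd u v hu hv => simp only [map_add, hu, hv]
    | ht ξ' ζ' =>
      have hincl : ∀ (η : E) (z : S.D.domain), inclDomain S E (BalancedTensor.tmul S.ρDom η z) =
          BalancedTensor.tmul S.ρH η (z : H) := fun _ _ => rfl
      rw [hincl, hincl, coupledMap_tmul, coupledMap_tmul, map_add, map_add, map_add, map_add,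
        LinearMap.add_apply, h.sH_tmul, h.sH_tmul, HermitianMetric.innerHE_tmul,
        HermitianMetric.innerHE_tmul, h.innerHE_sH_evalΩ_left,
        HermitianMetric.innerHE_tmul_left, h.contract_sH_evalΩ, h.compat]
      have h1 := congrArg (fun T : H →L[ℂ] H => T ζ') (hc ξ ξ')
      simp only [sub_apply] at h1
      rw [S.d_apply, sub_eq_iff_eq_add] at h1
      rw [h1, inner_add_right, inner_sub_right]
      have h2 := S.D_symmetric ζ (S.ρDom (h.metric.pair (h.s (τ.map ξ)) ξ') ζ')
      rw [TwistedSpectralTriple.coe_ρDom_apply] at h2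
      rw [h2]
      ring

variable [Module.Finite Aᵐᵒᵖ E] [Module.Projective Aᵐᵒᵖ E]

theorem coupledOperator_inclDomain (v : BalancedTensor E S.ρDom) :
    c.coupledOperator ⟨inclDomain S E v, v, rfl⟩ = c.coupledMap v := by
  change c.coupledMap _ = _
  congr 1
  exact (LinearEquiv.symm_apply_eq _).2 rfl

theorem coupledOperator_symm (hc : h.IsSigmaHermitian c) (x z : c.coupledOperator.domain) :
    h.metric.innerHE x (h.sH (c.coupledOperator z)) =
      h.metric.innerHE (h.sH (c.coupledOperator x)) z := by
  obtain ⟨_, v, rfl⟩ := x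
  obtain ⟨_, w, rfl⟩ := z
  rw [coupledOperator_inclDomain, coupledOperator_inclDomain]
  exact c.inner_coupledMap_symm h hc v w

/-- The approximation takes place in `Hⁿ`: the squared distance to `u` is continuous in the
coefficients with respect to a dual basis, and `(dom D)ⁿ` is dense. -/
theorem isDenselyDefined_coupledOperator : h.IsDenselyDefined c.coupledOperator := by
  intro u ε hε
  obtain ⟨n, e, φ, hE⟩ := BalancedTensor.exists_dualBasis (A := A) E
  let π : (Fin n → H) →ₗ[ℂ] BalancedTensor E S.ρH :=
    ∑ j, BalancedTensor.tmulHom E S.ρH (e j) ∘ₗ LinearMap.proj j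
  have hπ : ∀ x, π x = ∑ j, BalancedTensor.tmul S.ρH (e j) (x j) := fun x => by
    simp [π, BalancedTensor.tmul]
  let ζ : Fin n → H := fun j => BalancedTensor.contract S.ρH (φ j) u
  have hu : u = π ζ := by
    rw [hπ]
    exact BalancedTensor.eq_sum_tmul_contract S.ρH hE u
  let Φ : (Fin n → H) → ℝ := fun x => (h.metric.innerHE (π (ζ - x)) (π (ζ - x))).re
  have hΦ : Continuous Φ := by
    refine Complex.continuous_re.comp ?_
    simp only [hπ, map_sum, LinearMap.sum_apply, HermitianMetric.innerHE_tmul]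
    fun_prop
  have hd : Dense (Set.pi Set.univ fun _ : Fin n => (S.D.domain : Set H)) :=
    dense_pi _ fun _ _ => S.isSelfAdjoint_D.dense_domain
  have h0 : Φ ζ < ε ^ 2 := by
    simp only [Φ, sub_self, map_zero, Complex.zero_re]
    positivity
  obtain ⟨x, hx, hxd⟩ := hd.exists_mem_open (isOpen_lt hΦ continuous_const) ⟨ζ, h0⟩
  refine ⟨π x, ?_, ?_⟩
  · rw [hπ]
    exact Submodule.sum_mem _ fun j _ => c.tmul_mem_domain _ _ (hx j trivial)
  · rw [hu, ← map_sub]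
    exact hxd

theorem isSSelfAdjoint_coupledOperator (hc : h.IsSigmaHermitian c) :
    h.IsSSelfAdjoint c.coupledOperator := by
  refine ⟨c.isDenselyDefined_coupledOperator h, Set.Subset.antisymm ?_ ?_⟩
  · rintro ⟨x, y⟩ hxy z
    obtain ⟨x', rfl, rfl⟩ := (LinearPMap.mem_graph_iff _).1 hxy
    exact c.coupledOperator_symm h hc x' z
  · rintro ⟨x, y⟩ hxy
    have hpt : ∀ (ξ : E) (ζ : S.D.domain),
        h.metric.innerHE x (h.sH (BalancedTensor.tmul S.ρH (τ.map ξ) (S.D ζ) +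
          evalΩ S Eσ ζ (c.nabla ξ))) =
        h.metric.innerHE (h.sH y) (BalancedTensor.tmul S.ρH ξ (ζ : H)) := by
      intro ξ ζ
      rw [← c.coupledOperator_tmul ξ ζ ζ.2]
      exact hxy ⟨_, c.tmul_mem_domain ξ ζ ζ.2⟩
    have hdom : ∀ ξ, BalancedTensor.contract S.ρH (h.metric.pair ξ) x ∈ S.D.domain := by
      intro ξ
      -- The adjoint relation controls coefficients along `𝔰σ^E(ξ)` only; since `𝔰` and `σ^E` are
      -- onto, these are all coefficients.
      obtain ⟨ξ, rfl⟩ := h.s.surjective ξ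
      obtain ⟨ξ, rfl⟩ := τ.map.surjective ξ
      obtain ⟨v, hv⟩ := h.exists_innerHE_sH_evalΩ x (c.nabla ξ)
      refine S.mem_domain_of_inner _
        (BalancedTensor.contract S.ρH (h.metric.pair ξ) (h.sH y) - v) fun ζ => ?_
      have h1 := hpt ξ ζ
      rw [map_add, map_add, hv, h.sH_tmul, HermitianMetric.innerHE_tmul_right,
        HermitianMetric.innerHE_tmul_right] at h1
      rw [inner_sub_left, ← h1, add_sub_cancel_right]
    have hx : x ∈ c.coupledOperator.domain := by
      obtain ⟨n, e, η, hE⟩ := h.metric.exists_dualBasis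
      rw [BalancedTensor.eq_sum_tmul_contract S.ρH hE x]
      exact Submodule.sum_mem _ fun j _ => c.tmul_mem_domain _ _ (hdom _)
    refine (LinearPMap.mem_graph_iff _).2 ⟨⟨x, hx⟩, rfl, ?_⟩
    -- With `x` in the domain, symmetry and the adjoint relation give `𝔰D_∇x` and `𝔰y` the same
    -- pairing with every `ξ ⊗ ζ`, `ζ ∈ dom D`.
    have h0 : h.sH (c.coupledOperator ⟨x, hx⟩ - y) = 0 := by
      refine h.metric.eq_zero_of_innerHE S.isSelfAdjoint_D.dense_domain _ fun ξ ζ hζ => ?_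
      have h1 := c.coupledOperator_symm h hc ⟨x, hx⟩ ⟨_, c.tmul_mem_domain ξ ζ hζ⟩
      have h2 := hxy ⟨_, c.tmul_mem_domain ξ ζ hζ⟩
      rw [map_sub, map_sub, LinearMap.sub_apply, sub_eq_zero]
      exact h1.symm.trans h2
    rw [← sub_eq_zero, ← h.sHInv_sH (c.coupledOperator ⟨x, hx⟩ - y), h0, map_zero]

end SigmaConnection

end Modules

/-! ### Projections onto the graded components -/

namespace TwistedSpectralTriple

variable {A : Type*} [Ring A] [StarRing A] [Algebra ℂ A] [StarModule ℂ A]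
  {H : Type*} [NormedAddCommGroup H] [InnerProductSpace ℂ H] [CompleteSpace H]
  (S : TwistedSpectralTriple A H)

instance completeSpace_gr (i : ZMod 2) : CompleteSpace (S.gr i) :=
  (S.gr_isClosed i).completeSpace_coe

theorem starProjection_gr_eq_zero {i : ZMod 2} {x : H} (hx : x ∈ S.gr (i + 1)) :
    (S.gr i).starProjection x = 0 := by
  rw [S.gr_orthogonal] at hx
  exact (Submodule.starProjection_apply_eq_zero_iff _).2 hx

theorem starProjection_gr_add {i : ZMod 2} {x y : H} (hx : x ∈ S.gr i) (hy : y ∈ S.gr (i + 1)) :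
    (S.gr i).starProjection (x + y) = x := by
  rw [map_add, Submodule.starProjection_eq_self_iff.2 hx, S.starProjection_gr_eq_zero hy, add_zero]

theorem starProjection_gr_add_succ (i : ZMod 2) (x : H) :
    (S.gr i).starProjection x + (S.gr (i + 1)).starProjection x = x := by
  simp only [S.gr_orthogonal i]
  exact Submodule.starProjection_add_starProjection_orthogonal x

/-- Even operators preserve both summands, hence commute with the projections; this makes `1 ⊗ P`
well defined on the balanced tensor product. -/
theorem starProjection_gr_rep (i : ZMod 2) (a : A) (x : H) :
    (S.gr i).starProjection (S.ρH a x) = S.ρH a ((S.gr i).starProjection x) := by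
  conv_lhs => rw [← S.starProjection_gr_add_succ i x, map_add]
  exact S.starProjection_gr_add (S.rep_even a i _ (Submodule.starProjection_apply_mem _ _))
    (S.rep_even a (i + 1) _ (Submodule.starProjection_apply_mem _ _))

theorem starProjection_gr_mem_domain (i : ZMod 2) {x : H} (hx : x ∈ S.D.domain) :
    (S.gr i).starProjection x ∈ S.D.domain := by
  obtain ⟨y₀, h₀, y₁, h₁, rfl⟩ := S.domain_graded x hx
  have hi : i = 0 ∨ i = 1 := (by decide : ∀ j : ZMod 2, j = 0 ∨ j = 1) i
  rcases hi with rfl | rfl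
  · rw [S.starProjection_gr_add h₀.2 h₁.2]
    exact h₀.1
  · rw [add_comm, S.starProjection_gr_add h₁.2 h₀.2]
    exact h₁.1

end TwistedSpectralTriple

section Modules

variable {A : Type*} [Ring A] [StarRing A] [Algebra ℂ A] [StarModule ℂ A]
  {H : Type*} [NormedAddCommGroup H] [InnerProductSpace ℂ H] [CompleteSpace H]
  {S : TwistedSpectralTriple A H}
  {E : Type*} [AddCommGroup E] [Module ℂ E] [Module Aᵐᵒᵖ E] [IsScalarTower ℂ Aᵐᵒᵖ E]
  {Eσ : Type*} [AddCommGroup Eσ] [Module ℂ Eσ] [Module Aᵐᵒᵖ Eσ] [IsScalarTower ℂ Aᵐᵒᵖ Eσ]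

variable (S E) in
/-- The projection of `H(E)` onto `H^±(E)`. -/
def projHE (i : ZMod 2) : BalancedTensor E S.ρH →ₗ[ℂ] BalancedTensor E S.ρH :=
  BalancedTensor.mapRight S.ρH S.ρH ((S.gr i).starProjection : H →ₗ[ℂ] H)
    (S.starProjection_gr_rep i)

theorem projHE_tmul (i : ZMod 2) (ξ : E) (ζ : H) :
    projHE S E i (BalancedTensor.tmul S.ρH ξ ζ) =
      BalancedTensor.tmul S.ρH ξ ((S.gr i).starProjection ζ) :=
  rfl

theorem projHE_mem (i : ZMod 2) (u : BalancedTensor E S.ρH) : projHE S E i u ∈ gradedHE S E i := by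
  induction u using BalancedTensor.induction with
  | ht ξ ζ => exact Submodule.subset_span ⟨ξ, _, Submodule.starProjection_apply_mem _ ζ, rfl⟩
  | hadd u v hu hv => rw [map_add]; exact Submodule.add_mem _ hu hv

theorem projHE_of_mem {i : ZMod 2} {u : BalancedTensor E S.ρH} (hu : u ∈ gradedHE S E i) :
    projHE S E i u = u := by
  have : gradedHE S E i ≤ LinearMap.eqLocus (projHE S E i) LinearMap.id := by
    refine Submodule.span_le.2 ?_
    rintro _ ⟨ξ, ζ, hζ, rfl⟩
    change projHE S E i _ = _
    rw [projHE_tmul, Submodule.starProjection_eq_self_iff.2 hζ]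
    rfl
  exact this hu

theorem projHE_of_mem_succ {i : ZMod 2} {u : BalancedTensor E S.ρH}
    (hu : u ∈ gradedHE S E (i + 1)) : projHE S E i u = 0 := by
  have : gradedHE S E (i + 1) ≤ LinearMap.ker (projHE S E i) := by
    refine Submodule.span_le.2 ?_
    rintro _ ⟨ξ, ζ, hζ, rfl⟩
    change projHE S E i _ = _
    rw [projHE_tmul, S.starProjection_gr_eq_zero hζ]
    simp [BalancedTensor.tmul]
  exact this hu

theorem projHE_add_succ (i : ZMod 2) (u : BalancedTensor E S.ρH) :
    projHE S E i u + projHE S E (i + 1) u = u :=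
  LinearMap.congr_fun (BalancedTensor.hom_ext (f := projHE S E i + projHE S E (i + 1))
    (g := LinearMap.id) fun ξ ζ => by
      rw [LinearMap.add_apply, projHE_tmul, projHE_tmul, ← BalancedTensor.tmul_add,
        S.starProjection_gr_add_succ, LinearMap.id_apply]) u

theorem HermitianMetric.innerHE_projHE (h : HermitianMetric S E) (i : ZMod 2)
    (u v : BalancedTensor E S.ρH) :
    h.innerHE (projHE S E i u) v = h.innerHE u (projHE S E i v) := by
  induction u using BalancedTensor.induction with
  | hadd u w hu hw => simp only [map_add, LinearMap.add_apply, hu, hw]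
  | ht ξ ζ =>
    induction v using BalancedTensor.induction with
    | hadd u w hu hw => simp only [map_add, hu, hw]
    | ht ξ' ζ' =>
      rw [projHE_tmul, projHE_tmul, innerHE_tmul, innerHE_tmul,
        Submodule.inner_starProjection_left_eq_right]
      congr 1
      exact S.starProjection_gr_rep i _ _

theorem SigmaHermitianStructure.sH_projHE {τ : SigmaTranslation S E Eσ}
    (h : SigmaHermitianStructure τ) (i : ZMod 2) (y : BalancedTensor Eσ S.ρH) :
    h.sH (projHE S Eσ i y) = projHE S E i (h.sH y) :=
  LinearMap.congr_fun (BalancedTensor.hom_ext (f := h.sH ∘ₗ projHE S Eσ i)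
    (g := projHE S E i ∘ₗ h.sH) fun _ _ => rfl) y

namespace SigmaConnection

variable {τ : SigmaTranslation S E Eσ} (c : SigmaConnection τ)
  [Module.Finite Aᵐᵒᵖ E] [Module.Projective Aᵐᵒᵖ E]

theorem projHE_mem_gradedDomain (i : ZMod 2) (z : c.coupledOperator.domain) :
    projHE S E i z ∈ gradedDomain S E i := by
  obtain ⟨_, v, rfl⟩ := z
  change projHE S E i (inclDomain S E v) ∈ _
  induction v using BalancedTensor.induction with
  | ht ξ ζ =>
    exact Submodule.subset_span ⟨ξ, _, S.starProjection_gr_mem_domain i ζ.2,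
      Submodule.starProjection_apply_mem _ _, rfl⟩
  | hadd u v hu hv => rw [map_add, map_add]; exact Submodule.add_mem _ hu hv

/-- Split `z` into its two graded components: as `D_∇` is odd, only the one of degree `i`
contributes to degree `i + 1`. -/
theorem coupledOperatorGr_projHE (i : ZMod 2) (z : c.coupledOperator.domain) :
    (c.coupledOperatorGr i ⟨_, c.projHE_mem_gradedDomain i z⟩ : BalancedTensor Eσ S.ρH) =
      projHE S Eσ (i + 1) (c.coupledOperator z) := by
  have h1 : c.coupledOperator z =
      c.coupledOperatorGr i ⟨_, c.projHE_mem_gradedDomain i z⟩ +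
        c.coupledOperatorGr (i + 1) ⟨_, c.projHE_mem_gradedDomain (i + 1) z⟩ := by
    change _ = c.coupledOperator ⟨_, _⟩ + c.coupledOperator ⟨_, _⟩
    rw [← LinearPMap.map_add]
    congr 1
    exact Subtype.ext (projHE_add_succ i (z : BalancedTensor E S.ρH)).symm
  rw [h1, map_add, projHE_of_mem (Subtype.coe_prop _), projHE_of_mem_succ (Subtype.coe_prop _),
    add_zero]

end SigmaConnection

end Modules

/-! ### Parametrix and cokernels of the coupled operator -/

section Modules

variable {A : Type*} [Ring A] [StarRing A] [Algebra ℂ A] [StarModule ℂ A]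
  {H : Type*} [NormedAddCommGroup H] [InnerProductSpace ℂ H] [CompleteSpace H]
  {S : TwistedSpectralTriple A H}
  {E : Type*} [AddCommGroup E] [Module ℂ E] [Module Aᵐᵒᵖ E] [IsScalarTower ℂ Aᵐᵒᵖ E]
  {Eσ : Type*} [AddCommGroup Eσ] [Module ℂ Eσ] [Module Aᵐᵒᵖ Eσ] [IsScalarTower ℂ Aᵐᵒᵖ Eσ]

variable (S) in
/-- The map `Hⁿ → H(E)`, `x ↦ Σ_j e_j ⊗ x_j`. -/
def sumTmul {n : ℕ} (e : Fin n → E) :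
    PiLp 2 (fun _ : Fin n => H) →ₗ[ℂ] BalancedTensor E S.ρH :=
  ∑ j, BalancedTensor.tmulHom E S.ρH (e j) ∘ₗ (PiLp.projₗ 2 (fun _ : Fin n => H) j)

theorem sumTmul_apply {n : ℕ} (e : Fin n → E) (x : PiLp 2 (fun _ : Fin n => H)) :
    sumTmul S e x = ∑ j, BalancedTensor.tmul S.ρH (e j) (x j) := by
  simp [sumTmul, BalancedTensor.tmul]

namespace SigmaConnection

variable {τ : SigmaTranslation S E Eσ} (c : SigmaConnection τ)

/-- Exhibits the connection term as a finite family of bounded operators on `H`, one for each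
generator `e_k`. -/
theorem evalΩ_eq_sum {n : ℕ} {e : Fin n → Eσ} {φ : Fin n → (Eσ →ₗ[Aᵐᵒᵖ] A)}
    (hE : ∀ ξ : Eσ, ξ = ∑ j, MulOpposite.op (φ j ξ) • e j) (ζ : H)
    (w : BalancedTensor Eσ S.ρΩ) :
    evalΩ S Eσ ζ w = ∑ k, BalancedTensor.tmul S.ρH (e k)
      ((BalancedTensor.contract S.ρΩ (φ k) w : H →L[ℂ] H) ζ) := by
  conv_lhs => rw [BalancedTensor.eq_sum_tmul_contract S.ρΩ hE w, map_sum]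
  rfl

variable [Module.Finite Aᵐᵒᵖ E] [Module.Projective Aᵐᵒᵖ E]

/-- The resolvent of `D` yields a right inverse of `D_∇` up to a compact operator. -/
theorem exists_parametrix {n : ℕ} {e : Fin n → Eσ} {φ : Fin n → (Eσ →ₗ[Aᵐᵒᵖ] A)}
    (hE : ∀ ξ : Eσ, ξ = ∑ j, MulOpposite.op (φ j ξ) • e j) :
    ∃ K : PiLp 2 (fun _ : Fin n => H) →L[ℂ] PiLp 2 (fun _ : Fin n => H),
      IsCompactOperator K ∧ ∀ x, ∃ z, c.coupledOperator z = sumTmul S e (x + K x) := by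
  obtain ⟨R, hR, -, hR2⟩ := S.compact_resolvent
  let W : Fin n → Fin n → (H →L[ℂ] H) := fun k j =>
    BalancedTensor.contract S.ρΩ (φ k) (c.nabla (τ.map.symm (e j)))
  -- Since `DR = 1 - iR`, the error in `D_∇((σ^E)⁻¹(e_j) ⊗ Rx_j) ≈ e_j ⊗ x_j` is the connection term
  -- minus `e_j ⊗ iRx_j`. `L j` lifts it to `Hⁿ` as a bounded operator of `Rx_j`, so that composing
  -- with `R` makes it compact.
  let L : Fin n → (H →L[ℂ] PiLp 2 (fun _ : Fin n => H)) := fun j =>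
    (PiLp.continuousLinearEquiv 2 ℂ (fun _ : Fin n => H)).symm.toContinuousLinearMap ∘L
      ContinuousLinearMap.pi fun k => W k j - if k = j then Complex.I • 1 else 0
  have hL : ∀ j ζ, sumTmul S e (L j ζ) = evalΩ S Eσ ζ (c.nabla (τ.map.symm (e j))) -
      BalancedTensor.tmul S.ρH (e j) (Complex.I • ζ) := by
    intro j ζ
    have hk : ∀ k, L j ζ k = W k j ζ - if k = j then Complex.I • ζ else 0 := by
      intro k
      change (W k j - if k = j then Complex.I • 1 else 0 : H →L[ℂ] H) ζ = _
      split_ifs <;> simp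
    rw [sumTmul_apply, evalΩ_eq_sum hE]
    simp only [hk, BalancedTensor.tmul, map_sub, Finset.sum_sub_distrib]
    congr 1
    rw [Finset.sum_eq_single j] <;> simp +contextual
  refine ⟨∑ j, L j ∘L R ∘L PiLp.proj 2 (fun _ : Fin n => H) j, ?_, fun x => ?_⟩
  · refine Submodule.sum_mem (compactOperator (RingHom.id ℂ) _ _) fun j _ => ?_
    exact (hR.comp_clm (PiLp.proj 2 (fun _ : Fin n => H) j)).clm_comp (L j)
  · have hd : ∀ j, R (x j) ∈ S.D.domain := fun j => (hR2 (x j)).1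
    refine ⟨∑ j, ⟨_, c.tmul_mem_domain (τ.map.symm (e j)) (R (x j)) (hd j)⟩, ?_⟩
    have hT : ∀ z, c.coupledOperator z = c.coupledOperator.toFun z := fun _ => rfl
    rw [hT, map_sum, map_add, sumTmul_apply]
    simp only [← hT, sum_apply, map_sum]
    rw [← Finset.sum_add_distrib]
    refine Finset.sum_congr rfl fun j _ => ?_
    have h1 : S.D ⟨R (x j), hd j⟩ = x j - Complex.I • R (x j) :=
      eq_sub_of_add_eq (hR2 (x j)).2
    have h2 : (L j ∘L R ∘L PiLp.proj 2 (fun _ : Fin n => H) j) x = L j (R (x j)) := rfl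
    rw [c.coupledOperator_tmul _ _ (hd j), h1, h2, hL, LinearEquiv.apply_symm_apply]
    simp only [BalancedTensor.tmul, map_sub]
    abel

variable [Module.Finite Aᵐᵒᵖ Eσ] [Module.Projective Aᵐᵒᵖ Eσ]

theorem exists_finiteDimensional_sup_range :
    ∃ G : Submodule ℂ (BalancedTensor Eσ S.ρH), FiniteDimensional ℂ G ∧
      ∀ y, ∃ z, ∃ g ∈ G, y = c.coupledOperator z + g := by
  obtain ⟨n, e, φ, hE⟩ := BalancedTensor.exists_dualBasis (A := A) Eσ
  obtain ⟨K, hK, hKT⟩ := c.exists_parametrix hE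
  obtain ⟨F, hF, hFX⟩ := hK.range_one_add.1
  refine ⟨F.map (sumTmul S e), inferInstance, fun y => ?_⟩
  obtain ⟨u, f, hf, hu⟩ := hFX
    (WithLp.toLp 2 fun j => BalancedTensor.contract S.ρH (φ j) y)
  obtain ⟨z, hz⟩ := hKT u
  refine ⟨z, _, Submodule.mem_map_of_mem hf, ?_⟩
  rw [hz, ← map_add, ← hu, sumTmul_apply]
  exact BalancedTensor.eq_sum_tmul_contract S.ρH hE y

/-- Pulled back to `Hⁿ`, `g` vanishes on `ran (1 + K)` and so is continuous; and `ζ ↦ θ ⊗ ζ` lifts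
to the continuous map `ζ ↦ (φ_j(θ)ζ)_j` into `Hⁿ`. -/
theorem continuous_of_vanishes_on_range (g : BalancedTensor Eσ S.ρH →ₗ[ℂ] ℂ)
    (hg : ∀ z, g (c.coupledOperator z) = 0) (θ : Eσ) :
    Continuous fun ζ => g (BalancedTensor.tmul S.ρH θ ζ) := by
  obtain ⟨n, e, φ, hE⟩ := BalancedTensor.exists_dualBasis (A := A) Eσ
  obtain ⟨K, hK, hKT⟩ := c.exists_parametrix hE
  have hc : Continuous (g ∘ₗ sumTmul S e) := hK.range_one_add.2 _ fun x => by
    obtain ⟨z, hz⟩ := hKT x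
    rw [LinearMap.comp_apply, ← hz, hg]
  have he : (fun ζ => g (BalancedTensor.tmul S.ρH θ ζ)) = fun ζ =>
      (g ∘ₗ sumTmul S e) (WithLp.toLp 2 fun j => S.rep (φ j θ) ζ) := by
    funext ζ
    rw [LinearMap.comp_apply, sumTmul_apply]
    exact congrArg g (BalancedTensor.eq_sum_tmul_contract S.ρH hE (BalancedTensor.tmul S.ρH θ ζ))
  rw [he]
  fun_prop

/-! ### Duality between kernels and cokernels -/

variable (h : SigmaHermitianStructure τ)

/-- Riesz represents `g ∘ 𝔰⁻¹` by some `x`. Vanishing on the range says that `(x, 0)` is in the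
graph of the `𝔰`-adjoint, and selfadjointness turns this into `D_∇x = 0`. -/
theorem exists_mem_ker_of_vanishes_on_range (hc : h.IsSigmaHermitian c)
    (g : BalancedTensor Eσ S.ρH →ₗ[ℂ] ℂ) (hg : ∀ z, g (c.coupledOperator z) = 0) :
    ∃ x : c.coupledOperator.domain, c.coupledOperator x = 0 ∧
      ∀ y, h.metric.innerHE x (h.sH y) = g y := by
  obtain ⟨x, hx⟩ := h.metric.exists_innerHE_eq (g ∘ₗ h.sHInv) fun ξ =>
    c.continuous_of_vanishes_on_range g hg (h.s.symm ξ)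
  have hxy : ∀ y, h.metric.innerHE x (h.sH y) = g y := fun y => by
    rw [hx, LinearMap.comp_apply, h.sHInv_sH]
  have hgr : (x, (0 : BalancedTensor Eσ S.ρH)) ∈ h.sAdjointGraph c.coupledOperator := fun z => by
    change h.metric.innerHE x _ = h.metric.innerHE (h.sH 0) _
    rw [hxy, hg, map_zero, map_zero, LinearMap.zero_apply]
  rw [← (c.isSSelfAdjoint_coupledOperator h hc).2] at hgr
  obtain ⟨x', hx', h0⟩ := (LinearPMap.mem_graph_iff _).1 hgr
  exact ⟨x', h0, fun y => by rw [show (x' : BalancedTensor E S.ρH) = x from hx', hxy]⟩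

theorem finiteDimensional_coker (i : ZMod 2) :
    FiniteDimensional ℂ (gradedHE S Eσ (i + 1) ⧸ LinearMap.range (c.coupledOperatorGr i)) := by
  obtain ⟨G, hG, hGT⟩ := c.exists_finiteDimensional_sup_range
  let p : BalancedTensor Eσ S.ρH →ₗ[ℂ] gradedHE S Eσ (i + 1) :=
    (projHE S Eσ (i + 1)).codRestrict _ (projHE_mem (i + 1))
  refine Module.Finite.of_surjective
    ((LinearMap.range (c.coupledOperatorGr i)).mkQ ∘ₗ p ∘ₗ G.subtype) fun q => ?_
  obtain ⟨y, rfl⟩ := Submodule.mkQ_surjective _ q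
  obtain ⟨z, g, hg, hy⟩ := hGT y
  refine ⟨⟨g, hg⟩, (Submodule.Quotient.eq _).2 ?_⟩
  -- The degree `i + 1` part of `y = D_∇z + g` reads `y = D_∇(p_i z) + p_{i+1} g`, so `y` and
  -- `p_{i+1} g` have the same class.
  refine ⟨-⟨_, c.projHE_mem_gradedDomain i z⟩, Subtype.ext ?_⟩
  rw [map_neg, Submodule.coe_neg, coupledOperatorGr_projHE]
  change _ = projHE S Eσ (i + 1) g - (y : BalancedTensor Eσ S.ρH)
  conv_rhs => rw [← projHE_of_mem y.2, hy, map_add]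
  abel

/-- Linear functionals on the cokernel of `D_∇^±` are represented by the kernel of `D_∇^∓`. -/
theorem exists_ker_of_coker_functional (hc : h.IsSigmaHermitian c) (i : ZMod 2)
    (f : (gradedHE S Eσ (i + 1) ⧸ LinearMap.range (c.coupledOperatorGr i)) →ₗ[ℂ] ℂ) :
    ∃ x : LinearMap.ker (c.coupledOperatorGr (i + 1)), ∀ y : gradedHE S Eσ (i + 1),
      h.metric.innerHE (x : gradedDomain S E (i + 1)) (h.sH y) = f (Submodule.Quotient.mk y) := by
  let p : BalancedTensor Eσ S.ρH →ₗ[ℂ] gradedHE S Eσ (i + 1) :=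
    (projHE S Eσ (i + 1)).codRestrict _ (projHE_mem (i + 1))
  let g := f ∘ₗ (LinearMap.range (c.coupledOperatorGr i)).mkQ ∘ₗ p
  have hg : ∀ z, g (c.coupledOperator z) = 0 := by
    intro z
    have : p (c.coupledOperator z) ∈ LinearMap.range (c.coupledOperatorGr i) :=
      ⟨_, Subtype.ext (c.coupledOperatorGr_projHE i z)⟩
    change f (Submodule.Quotient.mk (p (c.coupledOperator z))) = 0
    rw [(Submodule.Quotient.mk_eq_zero _).2 this, map_zero]
  obtain ⟨x, hx0, hx⟩ := c.exists_mem_ker_of_vanishes_on_range h hc g hg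
  refine ⟨⟨⟨_, c.projHE_mem_gradedDomain (i + 1) x⟩, ?_⟩, fun y => ?_⟩
  · refine LinearMap.mem_ker.2 (Subtype.ext ?_)
    rw [coupledOperatorGr_projHE, hx0, map_zero]
    rfl
  · change h.metric.innerHE (projHE S E (i + 1) x) _ = _
    have hy : p y = y := Subtype.ext (projHE_of_mem y.2)
    rw [HermitianMetric.innerHE_projHE, ← h.sH_projHE, projHE_of_mem y.2, hx]
    change f (Submodule.Quotient.mk (p y)) = _
    rw [hy]

theorem innerHE_ker_range (hc : h.IsSigmaHermitian c) (i : ZMod 2)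
    (x : LinearMap.ker (c.coupledOperatorGr (i + 1))) (z : gradedDomain S E i) :
    h.metric.innerHE (x : gradedDomain S E (i + 1)) (h.sH (c.coupledOperatorGr i z)) = 0 := by
  have h1 := c.coupledOperator_symm h hc ⟨_, c.gradedDomain_le (i + 1) x.1.2⟩
    ⟨_, c.gradedDomain_le i z.2⟩
  have h2 : c.coupledOperator ⟨_, c.gradedDomain_le (i + 1) x.1.2⟩ = 0 :=
    congrArg Subtype.val (LinearMap.mem_ker.1 x.2)
  rw [h2, map_zero, map_zero, LinearMap.zero_apply] at h1
  exact h1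

theorem gradedDomain_le_gradedHE (i : ZMod 2) : gradedDomain S E i ≤ gradedHE S E i := by
  refine Submodule.span_mono ?_
  rintro _ ⟨ξ, ζ, -, hζ, rfl⟩
  exact ⟨ξ, ζ, hζ, rfl⟩

/-- The pairing of the kernel of `D_∇^∓` with the cokernel of `D_∇^±` is nondegenerate. -/
theorem ker_eq_zero_of_innerHE (i : ZMod 2) (x : LinearMap.ker (c.coupledOperatorGr i))
    (hx : ∀ y : gradedHE S Eσ i,
      h.metric.innerHE (h.sH y) (x : gradedDomain S E i) = 0) : x = 0 := by
  have h0 : ((x : gradedDomain S E i) : BalancedTensor E S.ρH) = 0 := by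
    refine h.metric.eq_zero_of_innerHE (V := ⊤) (by simp) _ fun ξ ζ _ => ?_
    have hxg := gradedDomain_le_gradedHE i x.1.2
    -- Each test vector is in the image of `𝔰 ⊗ 1`, and as `x` has degree `i` only its component of
    -- degree `i` matters.
    rw [← h.sH_sHInv (BalancedTensor.tmul S.ρH ξ ζ), ← projHE_of_mem hxg,
      HermitianMetric.innerHE_projHE, ← h.sH_projHE, ← HermitianMetric.conj_innerHE,
      hx ⟨_, projHE_mem i _⟩, map_zero]
  exact Subtype.ext (Subtype.ext h0)

/-- The pairing identifies the kernel with the dual of the finite-dimensional cokernel, but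
antilinearly. Pairing instead with lifts `y_j` of a basis, with the kernel in the linear slot, gives
a linear bijection `Ψ` onto `ℂⁿ`, which the basis identifies with the cokernel. -/
theorem nonempty_coker_equiv_ker (hc : h.IsSigmaHermitian c) (i : ZMod 2) :
    Nonempty ((gradedHE S Eσ (i + 1) ⧸ LinearMap.range (c.coupledOperatorGr i)) ≃ₗ[ℂ]
      LinearMap.ker (c.coupledOperatorGr (i + 1))) := by
  have hfin := c.finiteDimensional_coker i
  let n := Module.finrank ℂ
    (gradedHE S Eσ (i + 1) ⧸ LinearMap.range (c.coupledOperatorGr i))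
  let b := Module.finBasis ℂ (gradedHE S Eσ (i + 1) ⧸ LinearMap.range (c.coupledOperatorGr i))
  choose y hy using fun j => Submodule.Quotient.mk_surjective _ (b j)
  let Ψ : LinearMap.ker (c.coupledOperatorGr (i + 1)) →ₗ[ℂ] (Fin n → ℂ) :=
    LinearMap.pi fun j => h.metric.innerHE (h.sH (y j)) ∘ₗ (gradedDomain S E (i + 1)).subtype ∘ₗ
      (LinearMap.ker (c.coupledOperatorGr (i + 1))).subtype
  have hΨ : ∀ x j, Ψ x j = h.metric.innerHE (h.sH (y j)) (x : gradedDomain S E (i + 1)) :=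
    fun _ _ => rfl
  have hzero : ∀ x, Ψ x = 0 → x = 0 := by
    intro x hx
    refine c.ker_eq_zero_of_innerHE h (i + 1) x fun w => ?_
    -- The pairing with `x` descends to the cokernel, so its vanishing on the lifts of a basis
    -- forces it to vanish on all of `H^∓(E^σ)`.
    let f : (gradedHE S Eσ (i + 1) ⧸ LinearMap.range (c.coupledOperatorGr i)) →ₗ[ℂ] ℂ :=
      (LinearMap.range (c.coupledOperatorGr i)).liftQ
        (h.metric.innerHE (x : gradedDomain S E (i + 1)) ∘ₗ h.sH ∘ₗ
          (gradedHE S Eσ (i + 1)).subtype) (by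
          rintro _ ⟨z, rfl⟩
          exact c.innerHE_ker_range h hc i x z)
    have hf : f = 0 := b.ext fun j => by
      rw [← hy j]
      change h.metric.innerHE (x : gradedDomain S E (i + 1)) (h.sH (y j)) = 0
      rw [← HermitianMetric.conj_innerHE, ← hΨ, hx, Pi.zero_apply, map_zero]
    have h1 : h.metric.innerHE (x : gradedDomain S E (i + 1)) (h.sH w) = 0 :=
      LinearMap.congr_fun hf (Submodule.Quotient.mk w)
    rw [← HermitianMetric.conj_innerHE, h1, map_zero]
  have hinj : Function.Injective Ψ := fun x x' hxx =>
    sub_eq_zero.1 (hzero _ ((LinearMap.map_sub Ψ x x').trans (sub_eq_zero.2 hxx)))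
  have hsurj : Function.Surjective Ψ := by
    intro v
    -- The conjugates compensate for exchanging the arguments: `⟨x, 𝔰y_j⟩ = conj (v j)` means
    -- `⟨𝔰y_j, x⟩ = v j`.
    obtain ⟨x, hx⟩ := c.exists_ker_of_coker_functional h hc i (b.constr ℂ fun j => conj (v j))
    refine ⟨x, funext fun j => ?_⟩
    rw [hΨ, ← HermitianMetric.conj_innerHE, hx, hy, b.constr_basis, Complex.conj_conj]
  exact ⟨b.equivFun.trans (LinearEquiv.ofBijective Ψ ⟨hinj, hsurj⟩).symm⟩

end SigmaConnection

end Modules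

end

theorem mainTheorem12
    {A : Type*} [Ring A] [StarRing A] [Algebra ℂ A] [StarModule ℂ A]
    {H : Type*} [NormedAddCommGroup H] [InnerProductSpace ℂ H] [CompleteSpace H]
    (S : TwistedSpectralTriple A H)
    {E : Type*} [AddCommGroup E] [Module ℂ E] [Module Aᵐᵒᵖ E] [IsScalarTower ℂ Aᵐᵒᵖ E]
    [Module.Finite Aᵐᵒᵖ E] [Module.Projective Aᵐᵒᵖ E]
    {Eσ : Type*} [AddCommGroup Eσ] [Module ℂ Eσ] [Module Aᵐᵒᵖ Eσ] [IsScalarTower ℂ Aᵐᵒᵖ Eσ]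
    [Module.Finite Aᵐᵒᵖ Eσ] [Module.Projective Aᵐᵒᵖ Eσ]
    (τ : SigmaTranslation S E Eσ) (h : SigmaHermitianStructure τ)
    (c : SigmaConnection τ) (hc : h.IsSigmaHermitian c) :
    h.IsSSelfAdjoint c.coupledOperator ∧
      ∀ i : ZMod 2, Nonempty
        ((gradedHE S Eσ (i + 1) ⧸ LinearMap.range (c.coupledOperatorGr i)) ≃ₗ[ℂ]
          LinearMap.ker (c.coupledOperatorGr (i + 1))) :=
  ⟨c.isSSelfAdjoint_coupledOperator h hc, c.nonempty_coker_equiv_ker h hc⟩
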